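/- \textbf{Definitions.} A (multi-head) integer-weighted hyper temporal network (HyTN) $\mathcal H=(V,\mathcal A)$ consists of a finite set $V$ of nodes and a finite set $\mathcal A$ of hyperarcs $A=(t_A,H_A,w_A)$ with tail $t_A\in V$, nonempty set of heads $H_A\subseteq V\setminus\{t_A\}$ and weights $w_A:H_A\to\mathbb Z$. A schedule $s:V\to\mathbb R$ is \emph{feasible} if $s(t_A)\ge\min_{v\in H_A}\{s(v)-w_A(v)\}$ for all $A\in\mathcal A$; $\mathcal H$ is \emph{consistent} if it has a feasible schedule. A \emph{cycle} is a pair $(S,\mathcal C)$ with $S\subseteq V$, $\mathcal C\subseteq\mathcal A$, $\emptyset\ne S=\bigcup_{A\in\mathcal C}(H_A\cup\{t_A\})$, such that every $v\in S$ is the tail of exactly one hyperarc $a(v)\in\mathcal C$. It is \emph{negative} if $\sum_{i=1}^{p-1}w_{a(v_i)}(v_{i+1})<0$ for every finite cyclic sequence $v_1,\dots,v_p$ in it, i.e. $p\ge2$, $v_i\in S$ and $v_{i+1}\in H_{a(v_i)}$ for $1\le i<p$, and $v_p=v_1$ is the only repeated node. Let $m=\sum_{A\in\mathcal A}|H_A\cup\{t_A\}|$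 and $W=\max_{A\in\mathcal A}\max_{h\in H_A}|w_A(h)|$ (with $W=0$ if $\mathcal A=\emptyset$). The input is given by adjacency lists, and running times count the steps of a random access machine on integers with unit-cost addition, subtraction, comparison and indirect addressing; in the $O(\cdot)$ below, each of the factors $|V|+|\mathcal A|$, $m$, $W$ is read as $1$ when it is $0$. \textbf{Theorem.} \begin{enumerate} \item There is an algorithm running in time $O((|V|+|\mathcal A|)\,m\,W)$ that decides whether a given integer-weighted HyTN $\mathcal H$ is consistent. \item There is an algorithm running in time $O((|V|+|\mathcal A|)\,m\,W)$ that, given any consistent integer-weighted HyTN $\mathcal H$, outputs an integral feasible schedule $s:V\to\mathbb Z$ of $\mathcal H$. \item There is an algorithm running in time $O((|V|+|\mathcal A|)\,m\,W)$ that, given any integer-weighted HyTN $\mathcal H$ that is not consistent, outputs a negative cycle $(S,\mathcal C)$ of $\mathcal H$. \end{enumerate} -/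

import Mathlib

/-- A multi-head hyperarc `(t_A, H_A, w_A)` with integer weights on the node type `V`.
Only the values of `weight` on `heads` are meaningful. -/
structure Hyperarc (V : Type*) where
  tail : V
  heads : Finset V
  weight : V → ℤ
  heads_nonempty : heads.Nonempty
  tail_notMem_heads : tail ∉ heads

/-- An integer-weighted (multi-head) hyper temporal network with nodes `V` and hyperarcs
indexed by `ι`. -/
structure HyTN (V ι : Type*) where
  arc : ι → Hyperarc V

namespace HyTN

variable {V ι : Type*}

/-- A schedule `s : V → ℝ` is feasible when
`s(t_A) ≥ min_{v ∈ H_A} (s(v) - w_A(v))` for every hyperarc `A`. -/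
def Feasible (H : HyTN V ι) (s : V → ℝ) : Prop :=
  ∀ A : ι, (H.arc A).heads.inf' (H.arc A).heads_nonempty
    (fun v => s v - ((H.arc A).weight v : ℝ)) ≤ s (H.arc A).tail

/-- A network is consistent when it admits a feasible (real-valued) schedule. -/
def Consistent (H : HyTN V ι) : Prop := ∃ s : V → ℝ, H.Feasible s

/-- `(S, C)` is a cycle: `S` is the nonempty set of all tails and heads of hyperarcs of `C`, and
every node of `S` is the tail of exactly one hyperarc of `C`. -/
structure IsCycle (H : HyTN V ι) (S : Set V) (C : Set ι) : Prop where
  eq_iUnion : S = ⋃ A ∈ C, (((H.arc A).heads : Set V) ∪ {(H.arc A).tail})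
  nonempty : S.Nonempty
  existsUnique : ∀ v ∈ S, ∃! A, A ∈ C ∧ (H.arc A).tail = v

/-- A finite cyclic sequence `v 0, v 1, …, v l = v 0` in a cycle with hyperarc set `C`. The only
repetition is that of the first node at the end; `a t` is the hyperarc of `C` with tail `v t`, and
`v (t + 1)` is one of its heads. -/
structure IsCyclicSequence (H : HyTN V ι) (C : Set ι) (l : ℕ) (v : ℕ → V) (a : ℕ → ι) :
    Prop where
  pos : 0 < l
  closed : v l = v 0
  injOn : Set.InjOn v (Set.Iio l)
  arc_mem : ∀ t < l, a t ∈ C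
  tail_eq : ∀ t < l, (H.arc (a t)).tail = v t
  head_mem : ∀ t < l, v (t + 1) ∈ (H.arc (a t)).heads

/-- A cycle is negative when every finite cyclic sequence in it has negative total weight. -/
def IsNegativeCycle (H : HyTN V ι) (S : Set V) (C : Set ι) : Prop :=
  H.IsCycle S C ∧ ∀ (l : ℕ) (v : ℕ → V) (a : ℕ → ι), H.IsCyclicSequence C l v a →
    ∑ t ∈ Finset.range l, (H.arc (a t)).weight (v (t + 1)) < 0

/-- `m = ∑_A |A|`, where `|A| = |H_A ∪ {t_A}| = |H_A| + 1`. -/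
def size [Fintype ι] (H : HyTN V ι) : ℕ := ∑ A : ι, ((H.arc A).heads.card + 1)

/-- `W = max_A max_{h ∈ H_A} |w_A(h)|` (and `0` if there is no hyperarc). -/
def maxWeight [Fintype ι] (H : HyTN V ι) : ℕ :=
  Finset.univ.sup fun A : ι => (H.arc A).heads.sup fun h => ((H.arc A).weight h).natAbs

/-- A presentation of the head sets of a network by lists without repetition,
in an arbitrary order. -/
structure Listing (H : HyTN V ι) where
  list : ι → List V
  nodup : ∀ A, (list A).Nodup
  mem_iff : ∀ A v, v ∈ list A ↔ v ∈ (H.arc A).heads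

end HyTN

/-! A random access machine with unit-cost addition, subtraction, comparison and indirect
addressing, programmed by structured programs. -/

namespace RAM

/-- A machine state: integer registers, addressed directly, and integer arrays, addressed
indirectly through registers. A program mentions finitely many registers and arrays. -/
structure State where
  reg : ℕ → ℤ
  arr : ℕ → ℤ → ℤ

/-- The state after `X_x ← c`. -/
def State.setReg (σ : State) (x : ℕ) (c : ℤ) : State :=
  { σ with reg := Function.update σ.reg x c }

/-- The state after `M_m[i] ← c`. -/
def State.setArr (σ : State) (m : ℕ) (i c : ℤ) : State :=
  { σ with arr := Function.update σ.arr m (Function.update (σ.arr m) i c) }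

/-- Programs. -/
inductive Prog : Type where
  /-- no operation -/
  | skip : Prog
  /-- `X_x ← c` -/
  | const (x : ℕ) (c : ℤ) : Prog
  /-- `X_x ← X_y + X_z` -/
  | add (x y z : ℕ) : Prog
  /-- `X_x ← X_y - X_z` -/
  | sub (x y z : ℕ) : Prog
  /-- `X_x ← M_m[X_y]` -/
  | load (x m y : ℕ) : Prog
  /-- `M_m[X_y] ← X_x` -/
  | store (m y x : ℕ) : Prog
  /-- `P; Q` -/
  | seq (P Q : Prog) : Prog
  /-- `if X_x < X_y then P else Q` -/
  | cond (x y : ℕ) (P Q : Prog) : Prog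
  /-- `while X_x < X_y do P` -/
  | loop (x y : ℕ) (P : Prog) : Prog

/-- `Exec P σ τ t`: started in state `σ`, the program `P` halts in state `τ` after exactly `t` steps.
Each elementary instruction and each evaluation of a test is one step. -/
inductive Exec : Prog → State → State → ℕ → Prop where
  | skip (σ : State) : Exec Prog.skip σ σ 1
  | const (σ : State) (x : ℕ) (c : ℤ) : Exec (Prog.const x c) σ (σ.setReg x c) 1
  | add (σ : State) (x y z : ℕ) :
      Exec (Prog.add x y z) σ (σ.setReg x (σ.reg y + σ.reg z)) 1
  | sub (σ : State) (x y z : ℕ) :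
      Exec (Prog.sub x y z) σ (σ.setReg x (σ.reg y - σ.reg z)) 1
  | load (σ : State) (x m y : ℕ) :
      Exec (Prog.load x m y) σ (σ.setReg x (σ.arr m (σ.reg y))) 1
  | store (σ : State) (m y x : ℕ) :
      Exec (Prog.store m y x) σ (σ.setArr m (σ.reg y) (σ.reg x)) 1
  | seq {P Q : Prog} {σ τ ρ : State} {t u : ℕ} (hP : Exec P σ τ t) (hQ : Exec Q τ ρ u) :
      Exec (Prog.seq P Q) σ ρ (t + u)
  | cond_true {x y : ℕ} {P Q : Prog} {σ τ : State} {t : ℕ} (h : σ.reg x < σ.reg y)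
      (hP : Exec P σ τ t) : Exec (Prog.cond x y P Q) σ τ (t + 1)
  | cond_false {x y : ℕ} {P Q : Prog} {σ τ : State} {t : ℕ} (h : ¬ σ.reg x < σ.reg y)
      (hQ : Exec Q σ τ t) : Exec (Prog.cond x y P Q) σ τ (t + 1)
  | loop_done {x y : ℕ} {P : Prog} {σ : State} (h : ¬ σ.reg x < σ.reg y) :
      Exec (Prog.loop x y P) σ σ 1
  | loop_step {x y : ℕ} {P : Prog} {σ τ ρ : State} {t u : ℕ} (h : σ.reg x < σ.reg y)
      (hP : Exec P σ τ t) (hL : Exec (Prog.loop x y P) τ ρ u) :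
      Exec (Prog.loop x y P) σ ρ (t + u + 1)

/-- The array that holds a list in the cells `0, 1, …` and `0` in all other cells. -/
def arrayOfList (l : List ℤ) (i : ℤ) : ℤ := if 0 ≤ i then l.getD i.toNat 0 else 0

end RAM

namespace HyTN

/-- The input state for a network with nodes `0, …, n - 1` and hyperarcs `0, …, k - 1`, by
adjacency lists: register `0` holds `n`, register `1` holds `k`;
array `0` holds the tails of the hyperarcs;
arrays `2` and `3` hold the concatenated lists of heads of the hyperarcs `0, …, k - 1` and of
the weights of these heads;
array `1` holds in cell `A ≤ k` the position where the heads of hyperarc `A` start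
(the total number of heads if `A = k`).
Everything else is `0`. -/
def input {n k : ℕ} (H : HyTN (Fin n) (Fin k)) (L : H.Listing) : RAM.State where
  reg
    | 0 => n
    | 1 => k
    | _ => 0
  arr
    | 0 => RAM.arrayOfList ((List.finRange k).map fun A => (((H.arc A).tail : ℕ) : ℤ))
    | 1 => RAM.arrayOfList ((List.range (k + 1)).map fun j =>
        (((((List.finRange k).take j).map fun A => (L.list A).length).sum : ℕ) : ℤ))
    | 2 => RAM.arrayOfList
        ((List.finRange k).flatMap fun A => (L.list A).map fun v => ((v : ℕ) : ℤ))
    | 3 => RAM.arrayOfList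
        ((List.finRange k).flatMap fun A => (L.list A).map fun v => (H.arc A).weight v)
    | _ => fun _ => 0

end HyTN

/-! The algorithm is a value iteration that certifies its answer. It starts from the zero schedule
`f` and only raises values, namely at the tail of a hyperarc all of whose heads `h` have `f h - w h`
above the value of the tail. Either no violated hyperarc is left, and `f` is feasible and integral,
or some value exceeds `B = n * W`, and a negative cycle can be read off. A negative cycle excludes
consistency: following minimising heads of a feasible schedule around it closes up to a cyclic
sequence whose weight is nonnegative by telescoping. So the two outcomes decide consistency.

For the cycle, each raised node `v` remembers the hyperarc `a v` that raised it last. For its heads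
`h` this gives `f v + w h ≤ f h`, strictly unless `h` last changed before `v` (`Witnessed.raise`).
With `rank` the time of the last change and `T` above all ranks, `T * f - rank` grows by more than
`T * w h` along `a v`, which makes all cyclic sequences negative. Along `a` a value drops by at most
`W`, so the at most `n` nodes reached from one with value above `n * W` all have positive values,
hence chosen hyperarcs (`Search.visit`, `Search.isNegative`).

For the time, a hyperarc `A` does not rescan its heads at every change. It keeps a level `c A` and a
sweep pointer before which all heads exceed the level. Since values never fall, the pointer only
advances until the level rises by one, so each of the `B + 1` levels costs one sweep. Raising a node
costs a visit to the positions where it is a head, again linear in the total number `M` of heads per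
level. The potential `pot` adds up these costs; it starts at `3 * (B + 1) * M + M + n` and falls at
every step that keeps the iteration running. -/

namespace RAM

/-! ### Step-counting program logic -/

@[simp] theorem State.setReg_reg (σ : State) (x y : ℕ) (c : ℤ) :
    (σ.setReg x c).reg y = if y = x then c else σ.reg y := by
  simp [State.setReg, Function.update_apply]

@[simp] theorem State.setReg_arr (σ : State) (x : ℕ) (c : ℤ) : (σ.setReg x c).arr = σ.arr := rfl

@[simp] theorem State.setArr_reg (σ : State) (m : ℕ) (i c : ℤ) : (σ.setArr m i c).reg = σ.reg := rfl

@[simp] theorem State.setArr_arr (σ : State) (m m' : ℕ) (i c : ℤ) :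
    (σ.setArr m i c).arr m' = if m' = m then Function.update (σ.arr m) i c else σ.arr m' := by
  simp only [State.setArr, Function.update_apply]

infixr:60 " ;; " => Prog.seq

/-- `Reaches P σ T Q`: started in `σ`, the program halts within `T` steps in a state with `Q`. -/
def Reaches (P : Prog) (σ : State) (T : ℕ) (Q : State → Prop) : Prop :=
  ∃ (τ : State) (t : ℕ), Exec P σ τ t ∧ t ≤ T ∧ Q τ

theorem Reaches.seq {P P' : Prog} {σ : State} {T T' : ℕ} {Q Q' : State → Prop}
    (h : Reaches P σ T Q) (h' : ∀ τ, Q τ → Reaches P' τ T' Q') :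
    Reaches (P ;; P') σ (T + T') Q' := by
  obtain ⟨τ, t, e, ht, hq⟩ := h
  obtain ⟨ρ, u, e', hu, hq'⟩ := h' τ hq
  exact ⟨ρ, t + u, e.seq e', by omega, hq'⟩

theorem Reaches.mono {P : Prog} {σ : State} {T T' : ℕ} {Q Q' : State → Prop}
    (h : Reaches P σ T Q) (hT : T ≤ T') (hQ : ∀ τ, Q τ → Q' τ) : Reaches P σ T' Q' := by
  obtain ⟨τ, t, e, ht, hq⟩ := h
  exact ⟨τ, t, e, ht.trans hT, hQ τ hq⟩

theorem Reaches.cond {x y : ℕ} {P P' : Prog} {σ : State} {T : ℕ} {Q : State → Prop}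
    (h : σ.reg x < σ.reg y → Reaches P σ T Q) (h' : ¬ σ.reg x < σ.reg y → Reaches P' σ T Q) :
    Reaches (Prog.cond x y P P') σ (T + 1) Q := by
  by_cases c : σ.reg x < σ.reg y
  · obtain ⟨τ, t, e, ht, hq⟩ := h c
    exact ⟨τ, t + 1, Exec.cond_true c e, by omega, hq⟩
  · obtain ⟨τ, t, e, ht, hq⟩ := h' c
    exact ⟨τ, t + 1, Exec.cond_false c e, by omega, hq⟩

/-- A loop with invariant `I`, whose body takes at most `C` steps and decreases the potential `Φ`
as long as the loop goes on. -/
theorem Reaches.loop {x y : ℕ} {P : Prog} {C : ℕ} {I : State → Prop} {Φ : State → ℤ}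
    (hΦ : ∀ σ, I σ → σ.reg x < σ.reg y → 0 ≤ Φ σ)
    (hP : ∀ σ, I σ → σ.reg x < σ.reg y →
      Reaches P σ C fun τ => I τ ∧ (τ.reg x < τ.reg y → Φ τ < Φ σ))
    (σ : State) (hσ : I σ) :
    Reaches (Prog.loop x y P) σ ((C + 1) * (Φ σ + 1).toNat + 1)
      fun τ => I τ ∧ ¬ τ.reg x < τ.reg y := by
  induction hN : (Φ σ + 1).toNat using Nat.strong_induction_on generalizing σ with
  | _ N ih =>
  by_cases c : σ.reg x < σ.reg y
  · have h0 := hΦ σ hσ c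
    obtain ⟨τ, t, e, ht, hI, hlt⟩ := hP σ hσ c
    -- The potential has to fall only if the loop continues; the last pass may merely change a
    -- status register.
    by_cases c' : τ.reg x < τ.reg y
    · have h1 := hlt c'
      have h2 := hΦ τ hI c'
      have h3 : (Φ τ + 1).toNat < N := by omega
      obtain ⟨ρ, u, e', hu, hq⟩ := ih _ h3 τ hI rfl
      refine ⟨ρ, t + u + 1, Exec.loop_step c e e', ?_, hq⟩
      have h4 := Nat.mul_le_mul_left (C + 1) (Nat.succ_le_of_lt h3)
      rw [Nat.mul_succ] at h4
      omega
    · refine ⟨τ, t + 1 + 1, Exec.loop_step c e (Exec.loop_done c'), ?_, hI, c'⟩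
      have h4 := Nat.mul_le_mul_left (C + 1) (show 1 ≤ N by omega)
      omega
  · exact ⟨σ, 1, Exec.loop_done c, by omega, hσ, c⟩

/-- Weakest precondition of a loop-free program. -/
def wp : Prog → (State → Prop) → State → Prop
  | Prog.skip, Q, σ => Q σ
  | Prog.const x c, Q, σ => Q (σ.setReg x c)
  | Prog.add x y z, Q, σ => Q (σ.setReg x (σ.reg y + σ.reg z))
  | Prog.sub x y z, Q, σ => Q (σ.setReg x (σ.reg y - σ.reg z))
  | Prog.load x m y, Q, σ => Q (σ.setReg x (σ.arr m (σ.reg y)))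
  | Prog.store m y x, Q, σ => Q (σ.setArr m (σ.reg y) (σ.reg x))
  | Prog.seq P P', Q, σ => wp P (wp P' Q) σ
  | Prog.cond x y P P', Q, σ =>
    (σ.reg x < σ.reg y → wp P Q σ) ∧ (¬ σ.reg x < σ.reg y → wp P' Q σ)
  | Prog.loop _ _ _, _, _ => False

/-- An upper bound for the number of steps of a loop-free program. -/
def cost : Prog → ℕ
  | Prog.seq P Q => cost P + cost Q
  | Prog.cond _ _ P Q => max (cost P) (cost Q) + 1
  | _ => 1

theorem Reaches.of_wp {P : Prog} {Q : State → Prop} {σ : State} (h : wp P Q σ) :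
    Reaches P σ (cost P) Q := by
  induction P generalizing σ Q with
  | skip => exact ⟨_, _, Exec.skip σ, le_rfl, h⟩
  | const x c => exact ⟨_, _, Exec.const σ x c, le_rfl, h⟩
  | add x y z => exact ⟨_, _, Exec.add σ x y z, le_rfl, h⟩
  | sub x y z => exact ⟨_, _, Exec.sub σ x y z, le_rfl, h⟩
  | load x m y => exact ⟨_, _, Exec.load σ x m y, le_rfl, h⟩
  | store m y x => exact ⟨_, _, Exec.store σ m y x, le_rfl, h⟩
  | seq P P' ih ih' => exact (ih h).seq fun τ hτ => ih' hτ
  | cond x y P P' ih ih' =>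
    exact Reaches.cond (fun c => (ih (h.1 c)).mono (le_max_left _ _) fun _ h => h)
      fun c => (ih' (h.2 c)).mono (le_max_right _ _) fun _ h => h
  | loop => exact h.elim

end RAM

/-! ### Networks in array form and their lookup tables -/

/-- A network in array form: `n` nodes, `k` hyperarcs with tails `tl`, and `M` positions with heads
`hd` and weights `w`; the positions of the hyperarc `A` are those from `st A` to `st (A + 1) - 1`. -/
structure ArrayNet where
  n : ℤ
  k : ℤ
  M : ℤ
  tl : ℤ → ℤ
  st : ℤ → ℤ
  hd : ℤ → ℤ
  w : ℤ → ℤ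

namespace ArrayNet

structure Valid (N : ArrayNet) : Prop where
  n_nonneg : 0 ≤ N.n
  k_nonneg : 0 ≤ N.k
  st_zero : N.st 0 = 0
  st_k : N.st N.k = N.M
  st_lt : ∀ A, 0 ≤ A → A < N.k → N.st A < N.st (A + 1)
  tl_nonneg : ∀ A, 0 ≤ A → A < N.k → 0 ≤ N.tl A
  tl_lt : ∀ A, 0 ≤ A → A < N.k → N.tl A < N.n
  hd_nonneg : ∀ p, 0 ≤ p → p < N.M → 0 ≤ N.hd p
  hd_lt : ∀ p, 0 ≤ p → p < N.M → N.hd p < N.n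
  hd_ne : ∀ A p, 0 ≤ A → A < N.k → N.st A ≤ p → p < N.st (A + 1) → N.hd p ≠ N.tl A

variable {N : ArrayNet}

theorem Valid.st_mono (h : N.Valid) {A A' : ℤ} (hA : 0 ≤ A) (hAA : A ≤ A') (hA' : A' ≤ N.k) :
    N.st A ≤ N.st A' := by
  revert hA'
  induction A', hAA using Int.leInduction with
  | base => intro _; exact le_rfl
  | succ m hm ih => intro hk; exact (ih (by omega)).trans (h.st_lt m (by omega) (by omega)).le

theorem Valid.st_nonneg (h : N.Valid) {A : ℤ} (hA : 0 ≤ A) (hA' : A ≤ N.k) : 0 ≤ N.st A := by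
  have := h.st_mono le_rfl hA hA'; rwa [h.st_zero] at this

theorem Valid.st_le (h : N.Valid) {A : ℤ} (hA : 0 ≤ A) (hA' : A ≤ N.k) : N.st A ≤ N.M := by
  have := h.st_mono hA hA' le_rfl; rwa [h.st_k] at this

theorem Valid.M_nonneg (h : N.Valid) : 0 ≤ N.M := by
  have := h.st_nonneg h.k_nonneg le_rfl; rwa [h.st_k] at this

theorem Valid.arc_unique (h : N.Valid) {A A' p : ℤ} (hA : 0 ≤ A) (hAk : A < N.k) (hA' : 0 ≤ A')
    (hAk' : A' < N.k) (h1 : N.st A ≤ p) (h2 : p < N.st (A + 1)) (h1' : N.st A' ≤ p)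
    (h2' : p < N.st (A' + 1)) : A = A' := by
  rcases lt_trichotomy A A' with c | c | c
  · have := h.st_mono (A := A + 1) (A' := A') (by omega) (by omega) (by omega); omega
  · exact c
  · have := h.st_mono (A := A' + 1) (A' := A) (by omega) (by omega) (by omega); omega

/-- The number of positions below `x` with head `v`. -/
noncomputable def cnt (N : ArrayNet) (v x : ℤ) : ℤ := (((Finset.Ico 0 x).filter fun p => N.hd p = v).card : ℤ)

theorem cnt_nonneg (v x : ℤ) : 0 ≤ N.cnt v x := Int.natCast_nonneg _

theorem cnt_mono (v : ℤ) {x y : ℤ} (h : x ≤ y) : N.cnt v x ≤ N.cnt v y := by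
  unfold cnt
  exact_mod_cast Finset.card_le_card
    (Finset.filter_subset_filter _ (Finset.Ico_subset_Ico le_rfl h))

theorem cnt_lt {v x y : ℤ} (h : x < y) (hx : 0 ≤ x) (hv : N.hd (y - 1) = v) :
    N.cnt v x < N.cnt v y := by
  unfold cnt
  have : ((Finset.Ico 0 x).filter fun p => N.hd p = v).card <
      ((Finset.Ico 0 y).filter fun p => N.hd p = v).card := by
    apply Finset.card_lt_card
    rw [Finset.ssubset_iff_of_subset
      (Finset.filter_subset_filter _ (Finset.Ico_subset_Ico le_rfl h.le))]
    exact ⟨y - 1, by simp [hv]; omega, by simp; omega⟩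
  exact_mod_cast this

theorem cnt_zero (v : ℤ) : N.cnt v 0 = 0 := by simp [cnt]

theorem Valid.sum_cnt (h : N.Valid) : ∑ v ∈ Finset.Ico 0 N.n, N.cnt v N.M = N.M := by
  have := Finset.card_eq_sum_card_fiberwise (s := Finset.Ico 0 N.M) (t := Finset.Ico 0 N.n)
    (f := N.hd) (by
      intro p hp
      simp only [Finset.coe_Ico, Set.mem_Ico] at hp ⊢
      exact ⟨h.hd_nonneg p hp.1 hp.2, h.hd_lt p hp.1 hp.2⟩)
  have h2 : ((Finset.Ico 0 N.M).card : ℤ) = N.M := by simp [h.M_nonneg]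
  rw [this] at h2
  push_cast at h2
  exact h2

theorem Valid.sum_len (h : N.Valid) :
    ∑ A ∈ Finset.Ico 0 N.k, (N.st (A + 1) - N.st A) = N.M := by
  have key : ∀ x : ℤ, 0 ≤ x → ∑ A ∈ Finset.Ico 0 x, (N.st (A + 1) - N.st A) = N.st x - N.st 0 := by
    intro x hx
    induction x, hx using Int.leInduction with
    | base => simp
    | succ m hm ih =>
      rw [← Finset.insert_Ico_right_eq_Ico_add_one hm, Finset.sum_insert (by simp), ih]
      ring
  rw [key _ h.k_nonneg, h.st_k, h.st_zero, sub_zero]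

/-- Lookup tables for the positions below `x`: `g p` is the hyperarc of the position `p`; the
positions with head `v`, in decreasing order, are given by `fst v` and `nxt` (increased by `1`,
and `0` at the end). -/
structure Tables (N : ArrayNet) (g fst nxt : ℤ → ℤ) (x : ℤ) : Prop where
  g_nonneg : ∀ p, 0 ≤ p → p < x → 0 ≤ g p
  g_lt : ∀ p, 0 ≤ p → p < x → g p < N.k
  st_le : ∀ p, 0 ≤ p → p < x → N.st (g p) ≤ p
  lt_st : ∀ p, 0 ≤ p → p < x → p < N.st (g p + 1)
  fst_nonneg : ∀ v, 0 ≤ fst v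
  fst_le : ∀ v, fst v ≤ x
  hd_fst : ∀ v, 0 < fst v → N.hd (fst v - 1) = v
  fst_gap : ∀ v p, fst v ≤ p → p < x → N.hd p ≠ v
  nxt_nonneg : ∀ p, 0 ≤ p → p < x → 0 ≤ nxt p
  nxt_le : ∀ p, 0 ≤ p → p < x → nxt p ≤ p
  hd_nxt : ∀ p, 0 ≤ p → p < x → 0 < nxt p → N.hd (nxt p - 1) = N.hd p
  nxt_gap : ∀ p p', 0 ≤ p → p < x → nxt p ≤ p' → p' < p → N.hd p' ≠ N.hd p

/-- Links are shifted by one so that `0` means the end of a list; arrays filled with zeros are then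
already empty tables. -/
theorem Tables.zero : N.Tables (fun _ => 0) (fun _ => 0) (fun _ => 0) 0 := by
  constructor <;> intros <;> omega

/-- The new position is put in front of the list of its head, which is why the lists are decreasing.
-/
theorem Tables.step {g fst nxt : ℤ → ℤ} {p A : ℤ} (h : N.Tables g fst nxt p) (hp : 0 ≤ p)
    (hA : 0 ≤ A) (hAk : A < N.k) (h1 : N.st A ≤ p) (h2 : p < N.st (A + 1)) :
    N.Tables (Function.update g p A) (Function.update fst (N.hd p) (p + 1))
      (Function.update nxt p (fst (N.hd p))) (p + 1) := by
  have e : ∀ q, q < p + 1 → q ≠ p → q < p := by intros; omega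
  constructor
  · intro q hq hq'
    by_cases c : q = p
    · subst c; simpa using hA
    · simpa [c] using h.g_nonneg q hq (e q hq' c)
  · intro q hq hq'
    by_cases c : q = p
    · subst c; simpa using hAk
    · simpa [c] using h.g_lt q hq (e q hq' c)
  · intro q hq hq'
    by_cases c : q = p
    · subst c; simpa using h1
    · simpa [c] using h.st_le q hq (e q hq' c)
  · intro q hq hq'
    by_cases c : q = p
    · subst c; simpa using h2
    · simpa [c] using h.lt_st q hq (e q hq' c)
  · intro v
    by_cases c : v = N.hd p
    · subst c; simp; omega
    · simpa [c] using h.fst_nonneg v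
  · intro v
    by_cases c : v = N.hd p
    · subst c; simp
    · have := h.fst_le v
      simp [c]; omega
  · intro v
    by_cases c : v = N.hd p
    · subst c; simp
    · simpa [c] using h.hd_fst v
  · intro v q
    by_cases c : v = N.hd p
    · subst c; simp; omega
    · simp only [Function.update_of_ne c]
      intro hq hq'
      by_cases d : q = p
      · subst d; exact fun h => c h.symm
      · exact h.fst_gap v q hq (e q hq' d)
  · intro q hq hq'
    by_cases c : q = p
    · subst c; simpa using h.fst_nonneg _
    · simpa [c] using h.nxt_nonneg q hq (e q hq' c)
  · intro q hq hq'
    by_cases c : q = p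
    · subst c; simpa using h.fst_le _
    · simpa [c] using h.nxt_le q hq (e q hq' c)
  · intro q hq hq'
    by_cases c : q = p
    · subst c; simpa using h.hd_fst _
    · simpa [c] using h.hd_nxt q hq (e q hq' c)
  · intro q p' hq hq'
    by_cases c : q = p
    · subst c; simpa using h.fst_gap _ p'
    · simpa [c] using h.nxt_gap q p' hq (e q hq' c)

theorem Tables.g_eq {g fst nxt : ℤ → ℤ} (h : N.Tables g fst nxt N.M) (hN : N.Valid) {A p : ℤ}
    (hA : 0 ≤ A) (hAk : A < N.k) (h1 : N.st A ≤ p) (h2 : p < N.st (A + 1)) : g p = A := by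
  have h3 := hN.st_nonneg hA hAk.le
  have h4 := hN.st_le (A := A + 1) (by omega) (by omega)
  have h5 : 0 ≤ p := by omega
  have h6 : p < N.M := by omega
  exact hN.arc_unique (h.g_nonneg p h5 h6) (h.g_lt p h5 h6) hA hAk (h.st_le p h5 h6)
    (h.lt_st p h5 h6) h1 h2

/-! ### Value iteration: witnesses, invariant and potential -/

/-- The hyperarcs `a v` witness the values of `f`; `rank v` is the time of the last change at `v`,
and `T` is the current time. -/
structure Witnessed (N : ArrayNet) (f a rank : ℤ → ℤ) (T : ℤ) : Prop where
  rank_nonneg : ∀ v, 0 ≤ v → v < N.n → 0 ≤ rank v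
  rank_lt : ∀ v, 0 ≤ v → v < N.n → rank v < T
  a_nonneg : ∀ v, 0 ≤ v → v < N.n → 0 < f v → 0 ≤ a v
  a_lt : ∀ v, 0 ≤ v → v < N.n → 0 < f v → a v < N.k
  tl_a : ∀ v, 0 ≤ v → v < N.n → 0 < f v → N.tl (a v) = v
  le : ∀ v p, 0 ≤ v → v < N.n → 0 < f v → N.st (a v) ≤ p → p < N.st (a v + 1) →
    f v + N.w p ≤ f (N.hd p)
  lt : ∀ v p, 0 ≤ v → v < N.n → 0 < f v → N.st (a v) ≤ p → p < N.st (a v + 1) →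
    f v + N.w p < f (N.hd p) ∨ rank (N.hd p) < rank v

/-- The raised tail gets the current time as rank, larger than the ranks of all its heads. For
another node that has the raised tail among its heads, the inequality becomes strict, so the new
rank does no harm. -/
theorem Witnessed.raise {f a rank : ℤ → ℤ} {T A x : ℤ} (h : N.Witnessed f a rank T) (hN : N.Valid)
    (hA : 0 ≤ A) (hAk : A < N.k) (hx : f (N.tl A) < x)
    (hle : ∀ p, N.st A ≤ p → p < N.st (A + 1) → x + N.w p ≤ f (N.hd p)) (hT : 0 ≤ T) :
    N.Witnessed (Function.update f (N.tl A) x) (Function.update a (N.tl A) A)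
      (Function.update rank (N.tl A) T) (T + 1) := by
  have range : ∀ v p, 0 ≤ a v → a v < N.k → N.st (a v) ≤ p → p < N.st (a v + 1) →
      0 ≤ N.hd p ∧ N.hd p < N.n := by
    intro v p h1 h2 h3 h4
    have h5 := hN.st_nonneg h1 h2.le
    have h6 := hN.st_le (A := a v + 1) (by omega) (by omega)
    exact ⟨hN.hd_nonneg p (by omega) (by omega), hN.hd_lt p (by omega) (by omega)⟩
  have rangeA : ∀ p, N.st A ≤ p → p < N.st (A + 1) → 0 ≤ N.hd p ∧ N.hd p < N.n := by
    intro p h3 h4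
    have h5 := hN.st_nonneg hA hAk.le
    have h6 := hN.st_le (A := A + 1) (by omega) (by omega)
    exact ⟨hN.hd_nonneg p (by omega) (by omega), hN.hd_lt p (by omega) (by omega)⟩
  constructor
  · intro v hv hvn
    by_cases c : v = N.tl A
    · subst c; simpa using hT
    · simpa [c] using h.rank_nonneg v hv hvn
  · intro v hv hvn
    by_cases c : v = N.tl A
    · subst c; simp
    · have := h.rank_lt v hv hvn
      simp [c]; omega
  · intro v hv hvn
    by_cases c : v = N.tl A
    · subst c; simp [hA]
    · simpa [c] using h.a_nonneg v hv hvn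
  · intro v hv hvn
    by_cases c : v = N.tl A
    · subst c; simp [hAk]
    · simpa [c] using h.a_lt v hv hvn
  · intro v hv hvn
    by_cases c : v = N.tl A
    · subst c; simp
    · simpa [c] using h.tl_a v hv hvn
  · intro v p hv hvn
    by_cases c : v = N.tl A
    · subst c
      simp only [Function.update_self]
      intro _ h1 h2
      rw [Function.update_of_ne (hN.hd_ne A p hA hAk h1 h2)]
      exact hle p h1 h2
    · simp only [Function.update_of_ne c]
      intro h0 h1 h2
      have h3 := h.le v p hv hvn h0 h1 h2
      by_cases d : N.hd p = N.tl A
      · rw [d] at h3 ⊢; simp; omega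
      · rwa [Function.update_of_ne d]
  · intro v p hv hvn
    by_cases c : v = N.tl A
    · subst c
      simp only [Function.update_self]
      intro _ h1 h2
      rw [Function.update_of_ne (hN.hd_ne A p hA hAk h1 h2),
        Function.update_of_ne (hN.hd_ne A p hA hAk h1 h2)]
      have := rangeA p h1 h2
      exact Or.inr (h.rank_lt _ this.1 this.2)
    · simp only [Function.update_of_ne c]
      intro h0 h1 h2
      by_cases d : N.hd p = N.tl A
      · have h3 := h.le v p hv hvn h0 h1 h2
        rw [d] at h3 ⊢; simp; omega
      · rw [Function.update_of_ne d, Function.update_of_ne d]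
        exact h.lt v p hv hvn h0 h1 h2

/-- Every hyperarc is satisfied by `f`. -/
def Satisfied (N : ArrayNet) (f : ℤ → ℤ) : Prop :=
  ∀ A, 0 ≤ A → A < N.k → ∃ p, N.st A ≤ p ∧ p < N.st (A + 1) ∧ f (N.hd p) - N.w p ≤ f (N.tl A)

/-- Invariant of the value iteration: `f` are the values of the nodes, `c` those of the hyperarcs,
`off` the sweep pointers; `Q` is the queue, from `qh` to `qt`, of raised nodes, and `cur - 1` is the
next position to be examined for the node taken last from the queue. -/
structure Iter (N : ArrayNet) (B : ℤ) (f c off a Q : ℤ → ℤ) (cur qh qt : ℤ) : Prop where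
  f_le : ∀ v, 0 ≤ v → v < N.n → f v ≤ B
  c_le : ∀ A, 0 ≤ A → A < N.k → c A ≤ f (N.tl A)
  c_nonneg : ∀ A, 0 ≤ A → A < N.k → 0 ≤ c A
  off_nonneg : ∀ A, 0 ≤ A → A < N.k → 0 ≤ off A
  off_lt : ∀ A, 0 ≤ A → A < N.k → N.st A + off A < N.st (A + 1)
  swept : ∀ A p, 0 ≤ A → A < N.k → N.st A ≤ p → p < N.st A + off A → c A < f (N.hd p) - N.w p
  qh_nonneg : 0 ≤ qh
  qh_le : qh ≤ qt
  Q_nonneg : ∀ i, qh ≤ i → i < qt → 0 ≤ Q i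
  Q_lt : ∀ i, qh ≤ i → i < qt → Q i < N.n
  cur_nonneg : 0 ≤ cur
  cur_le : cur ≤ N.M
  pending : ∀ A, 0 ≤ A → A < N.k → f (N.hd (N.st A + off A)) - N.w (N.st A + off A) ≤ c A ∨
    ∃ p, N.st A ≤ p ∧ p < N.st (A + 1) ∧
      ((p < cur ∧ N.hd p = N.hd (cur - 1)) ∨ ∃ i, qh ≤ i ∧ i < qt ∧ Q i = N.hd p)
  witnessed : ∃ rank, N.Witnessed f a rank qt

/-- The potential of the value iteration. -/
noncomputable def pot (N : ArrayNet) (B : ℤ) (f c off Q : ℤ → ℤ) (cur qh qt : ℤ) : ℤ :=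
  ∑ v ∈ Finset.Ico 0 N.n, (B + 1 - f v) * N.cnt v N.M +
  2 * ∑ A ∈ Finset.Ico 0 N.k, ((B + 1 - c A) * (N.st (A + 1) - N.st A) - off A) +
  ∑ i ∈ Finset.Ico qh qt, (N.cnt (Q i) N.M + 1) + N.cnt (N.hd (cur - 1)) cur

theorem sum_Ico_congr_except {F G : ℤ → ℤ} {n x : ℤ} (hx : 0 ≤ x) (hxn : x < n)
    (h : ∀ v, v ≠ x → F v = G v) :
    ∑ v ∈ Finset.Ico 0 n, F v = ∑ v ∈ Finset.Ico 0 n, G v + (F x - G x) := by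
  have hm : x ∈ Finset.Ico 0 n := by simp [hx, hxn]
  rw [← Finset.add_sum_erase _ F hm, ← Finset.add_sum_erase _ G hm,
    Finset.sum_congr rfl fun v hv => h v (Finset.ne_of_mem_erase hv)]
  ring

variable {B : ℤ} {f c off a Q g fst nxt : ℤ → ℤ} {cur qh qt : ℤ}

theorem Iter.pot_nonneg (h : N.Iter B f c off a Q cur qh qt) (hN : N.Valid) :
    0 ≤ N.pot B f c off Q cur qh qt := by
  unfold pot
  have h1 : 0 ≤ ∑ v ∈ Finset.Ico 0 N.n, (B + 1 - f v) * N.cnt v N.M := by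
    refine Finset.sum_nonneg fun v hv => ?_
    simp only [Finset.mem_Ico] at hv
    have := h.f_le v hv.1 hv.2
    exact mul_nonneg (by omega) (cnt_nonneg _ _)
  have h2 : 0 ≤ ∑ A ∈ Finset.Ico 0 N.k, ((B + 1 - c A) * (N.st (A + 1) - N.st A) - off A) := by
    refine Finset.sum_nonneg fun A hA => ?_
    simp only [Finset.mem_Ico] at hA
    have h3 := h.f_le _ (hN.tl_nonneg A hA.1 hA.2) (hN.tl_lt A hA.1 hA.2)
    have h4 := h.c_le A hA.1 hA.2
    have h5 := h.off_lt A hA.1 hA.2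
    have h6 := h.off_nonneg A hA.1 hA.2
    -- Since `c A ≤ B`, the term is at least the length minus the pointer, which is positive.
    nlinarith
  have h3 : 0 ≤ ∑ i ∈ Finset.Ico qh qt, (N.cnt (Q i) N.M + 1) :=
    Finset.sum_nonneg fun i _ => by have := N.cnt_nonneg (Q i) N.M; omega
  have h4 := N.cnt_nonneg (N.hd (cur - 1)) cur
  omega

theorem Iter.init (hN : N.Valid) (hB : 0 ≤ B) (hQ : ∀ i, 0 ≤ i → i < N.n → Q i = i) :
    N.Iter B (fun _ => 0) (fun _ => 0) (fun _ => 0) (fun _ => 0) Q 0 0 N.n where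
  f_le := by simp [hB]
  c_le := by simp
  c_nonneg := by simp
  off_nonneg := by simp
  off_lt := by simpa using hN.st_lt
  swept := by intros; omega
  qh_nonneg := le_rfl
  qh_le := hN.n_nonneg
  Q_nonneg := by intro i h1 h2; rw [hQ i h1 h2]; exact h1
  Q_lt := by intro i h1 h2; rw [hQ i h1 h2]; exact h2
  cur_nonneg := le_rfl
  cur_le := hN.M_nonneg
  pending := by
    intro A hA hAk
    have h1 := hN.st_lt A hA hAk
    have h2 := hN.st_nonneg hA hAk.le
    have h3 := hN.st_le (A := A + 1) (by omega) (by omega)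
    have h4 := hN.hd_nonneg (N.st A) (by omega) (by omega)
    have h5 := hN.hd_lt (N.st A) (by omega) (by omega)
    exact Or.inr ⟨N.st A, le_rfl, h1, Or.inr ⟨N.hd (N.st A), h4, h5, hQ _ h4 h5⟩⟩
  witnessed := ⟨fun _ => 0, by constructor <;> intros <;> omega⟩

theorem pot_init (hN : N.Valid) (hQ : ∀ i, 0 ≤ i → i < N.n → Q i = i) :
    N.pot B (fun _ => 0) (fun _ => 0) (fun _ => 0) Q 0 0 N.n = 3 * (B + 1) * N.M + N.M + N.n := by
  unfold pot
  have h1 : ∑ i ∈ Finset.Ico 0 N.n, (N.cnt (Q i) N.M + 1) = N.M + N.n := by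
    rw [Finset.sum_congr rfl (g := fun i => N.cnt i N.M + 1), Finset.sum_add_distrib, hN.sum_cnt]
    · simp [hN.n_nonneg]
    · intro i hi
      simp only [Finset.mem_Ico] at hi
      rw [hQ i hi.1 hi.2]
  simp only [sub_zero, h1, ← Finset.mul_sum, hN.sum_cnt, hN.sum_len, cnt_zero]
  ring

/-- The old list is exhausted, so no hyperarc relies on it; those relying on the removed queue entry
now rely on its list. The weight of a queue entry, in-degree plus one, pays for the list and for the
step. -/
theorem Iter.pop (h : N.Iter B f c off a Q cur qh qt) (hN : N.Valid)
    (ht : N.Tables g fst nxt N.M) (hc : ¬ 0 < cur) (hq : qh < qt) :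
    N.Iter B f c off a Q (fst (Q qh)) (qh + 1) qt ∧
      N.pot B f c off Q (fst (Q qh)) (qh + 1) qt < N.pot B f c off Q cur qh qt := by
  have h0 : cur = 0 := le_antisymm (not_lt.1 hc) h.cur_nonneg
  subst h0
  constructor
  · refine { h with
      qh_nonneg := by have := h.qh_nonneg; omega
      qh_le := by omega
      Q_nonneg := fun i h1 h2 => h.Q_nonneg i (by omega) h2
      Q_lt := fun i h1 h2 => h.Q_lt i (by omega) h2
      cur_nonneg := ht.fst_nonneg _
      cur_le := ht.fst_le _
      pending := ?_ }
    intro A hA hAk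
    rcases h.pending A hA hAk with h1 | ⟨p, h1, h2, h3⟩
    · exact Or.inl h1
    · have h0 := hN.st_nonneg hA hAk.le
      have hM := hN.st_le (A := A + 1) (by omega) (by omega)
      rcases h3 with ⟨h3, -⟩ | ⟨i, h3, h4, h5⟩
      · omega
      · refine Or.inr ⟨p, h1, h2, ?_⟩
        by_cases ci : i = qh
        · subst ci
          have h6 : p < fst (Q i) := by
            by_contra h6
            exact ht.fst_gap (Q i) p (not_lt.1 h6) (by omega) h5.symm
          exact Or.inl ⟨h6, by rw [ht.hd_fst _ (by omega), h5]⟩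
        · exact Or.inr ⟨i, by omega, h4, h5⟩
  · unfold pot
    rw [← Finset.insert_Ico_add_one_left_eq_Ico hq, Finset.sum_insert (by simp), cnt_zero]
    have h2 : N.cnt (N.hd (fst (Q qh) - 1)) (fst (Q qh)) ≤ N.cnt (Q qh) N.M := by
      by_cases c : 0 < fst (Q qh)
      · rw [ht.hd_fst _ c]
        exact cnt_mono _ (ht.fst_le _)
      · have := ht.fst_nonneg (Q qh)
        rw [show fst (Q qh) = 0 by omega, cnt_zero]
        exact cnt_nonneg _ _
    omega

/-- With list and queue empty, `pending` leaves only its first alternative, and `c A` is at most the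
value of the tail. The position at the sweep pointer is the required head. -/
theorem Iter.satisfied (h : N.Iter B f c off a Q cur qh qt) (hN : N.Valid) (hc : ¬ 0 < cur)
    (hq : ¬ qh < qt) : N.Satisfied f := by
  intro A hA hAk
  have h1 := h.off_nonneg A hA hAk
  have h2 := h.off_lt A hA hAk
  have h3 := h.c_le A hA hAk
  have h4 := hN.st_nonneg hA hAk.le
  refine ⟨N.st A + off A, by omega, h2, ?_⟩
  rcases h.pending A hA hAk with h5 | ⟨p, h5, h6, ⟨h7, -⟩ | ⟨i, h7, h8, -⟩⟩ <;> omega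

/-- Only the hyperarc of the position `cur - 1` can lose its pending position, and the test has just
shown that this hyperarc is fine at its sweep pointer. -/
theorem Iter.next (h : N.Iter B f c off a Q cur qh qt) (hN : N.Valid)
    (ht : N.Tables g fst nxt N.M) (hc : 0 < cur)
    (hs : ¬ c (g (cur - 1)) < f (N.hd (N.st (g (cur - 1)) + off (g (cur - 1)))) -
      N.w (N.st (g (cur - 1)) + off (g (cur - 1)))) :
    N.Iter B f c off a Q (nxt (cur - 1)) qh qt ∧
      N.pot B f c off Q (nxt (cur - 1)) qh qt < N.pot B f c off Q cur qh qt := by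
  have hM := h.cur_le
  have n0 := ht.nxt_nonneg (cur - 1) (by omega) (by omega)
  have n1 := ht.nxt_le (cur - 1) (by omega) (by omega)
  constructor
  · refine { h with
      cur_nonneg := n0
      cur_le := by omega
      pending := ?_ }
    intro A hA hAk
    rcases h.pending A hA hAk with h1 | ⟨p, h1, h2, ⟨h3, h4⟩ | h3⟩
    · exact Or.inl h1
    · by_cases hp : p = cur - 1
      · subst hp
        rw [ht.g_eq hN hA hAk h1 h2] at hs
        exact Or.inl (not_lt.1 hs)
      · have h5 : p < nxt (cur - 1) := by
          by_contra h5
          exact ht.nxt_gap (cur - 1) p (by omega) (by omega) (not_lt.1 h5) (by omega) h4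
        have := hN.st_nonneg hA hAk.le
        refine Or.inr ⟨p, h1, h2, Or.inl ⟨h5, ?_⟩⟩
        rw [ht.hd_nxt (cur - 1) (by omega) (by omega) (by omega), h4]
    · exact Or.inr ⟨p, h1, h2, Or.inr h3⟩
  · have h2 : N.cnt (N.hd (nxt (cur - 1) - 1)) (nxt (cur - 1)) < N.cnt (N.hd (cur - 1)) cur := by
      have h3 := cnt_lt (N := N) (x := nxt (cur - 1)) (y := cur) (by omega) n0 rfl
      by_cases hp : 0 < nxt (cur - 1)
      · rwa [ht.hd_nxt (cur - 1) (by omega) (by omega) hp]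
      · rw [show nxt (cur - 1) = 0 by omega, cnt_zero] at h3 ⊢
        exact h3
    unfold pot
    omega

/-- The part of the potential that belongs to the hyperarcs. -/
theorem sum_arc_update {A x y : ℤ} (hA : 0 ≤ A) (hAk : A < N.k) :
    ∑ A' ∈ Finset.Ico 0 N.k, ((B + 1 - Function.update c A x A') * (N.st (A' + 1) - N.st A') -
        Function.update off A y A') =
      ∑ A' ∈ Finset.Ico 0 N.k, ((B + 1 - c A') * (N.st (A' + 1) - N.st A') - off A') +
        ((c A - x) * (N.st (A + 1) - N.st A) + off A - y) := by
  rw [sum_Ico_congr_except hA hAk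
    (G := fun A' => (B + 1 - c A') * (N.st (A' + 1) - N.st A') - off A')]
  · simp only [Function.update_self]; ring
  · intro v hv
    simp [hv]

/-- The hyperarc examined at the position `cur - 1` is violated at its sweep pointer. -/
structure Violated (N : ArrayNet) (f c off : ℤ → ℤ) (cur A : ℤ) : Prop where
  cur_pos : 0 < cur
  nonneg : 0 ≤ A
  lt : A < N.k
  le_pos : N.st A ≤ cur - 1
  pos_lt : cur - 1 < N.st (A + 1)
  violated : c A < f (N.hd (N.st A + off A)) - N.w (N.st A + off A)

theorem Iter.violated (h : N.Iter B f c off a Q cur qh qt) (ht : N.Tables g fst nxt N.M)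
    (hc : 0 < cur) (hs : c (g (cur - 1)) < f (N.hd (N.st (g (cur - 1)) + off (g (cur - 1)))) -
      N.w (N.st (g (cur - 1)) + off (g (cur - 1)))) : N.Violated f c off cur (g (cur - 1)) := by
  have hM := h.cur_le
  exact ⟨hc, ht.g_nonneg _ (by omega) (by omega), ht.g_lt _ (by omega) (by omega),
    ht.st_le _ (by omega) (by omega), ht.lt_st _ (by omega) (by omega), hs⟩

variable {A : ℤ}

/-- The position `cur - 1` is kept, so the hyperarc stays pending and is examined again at its new
pointer. -/
theorem Iter.sweep (h : N.Iter B f c off a Q cur qh qt) (hv : N.Violated f c off cur A)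
    (hlt : N.st A + off A + 1 < N.st (A + 1)) :
    N.Iter B f c (Function.update off A (off A + 1)) a Q cur qh qt ∧
      N.pot B f c (Function.update off A (off A + 1)) Q cur qh qt <
        N.pot B f c off Q cur qh qt := by
  obtain ⟨hc, hA, hAk, hp, hp', hs⟩ := hv
  constructor
  · refine { h with
      off_nonneg := ?_
      off_lt := ?_
      swept := ?_
      pending := ?_ }
    · intro A' h1 h2
      have := h.off_nonneg A' h1 h2
      by_cases e : A' = A
      · subst e; simp; omega
      · simpa [e] using this
    · intro A' h1 h2
      by_cases e : A' = A
      · subst e; simp; omega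
      · simpa [e] using h.off_lt A' h1 h2
    · intro A' p h1 h2 h3
      by_cases e : A' = A
      · subst e
        simp only [Function.update_self]
        intro h4
        by_cases e' : p = N.st A' + off A'
        · subst e'; exact hs
        · exact h.swept A' p h1 h2 h3 (by omega)
      · simpa [e] using h.swept A' p h1 h2 h3
    · intro A' h1 h2
      by_cases e : A' = A
      · subst e; exact Or.inr ⟨cur - 1, hp, hp', Or.inl ⟨by omega, rfl⟩⟩
      · simpa [e] using h.pending A' h1 h2
  · have := sum_arc_update (N := N) (B := B) (c := c) (off := off) (x := c A) (y := off A + 1) hA hAk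
    simp only [Function.update_eq_self] at this
    unfold pot
    rw [this]
    simp

/-- The sweep is complete: the level rises by one and the pointer returns to the start. The gain of
the full length exceeds the loss of the pointer value by one. -/
theorem Iter.lift (h : N.Iter B f c off a Q cur qh qt) (hv : N.Violated f c off cur A)
    (hN : N.Valid) (hlt : ¬ N.st A + off A + 1 < N.st (A + 1)) (hf : ¬ f (N.tl A) < c A + 1) :
    N.Iter B f (Function.update c A (c A + 1)) (Function.update off A 0) a Q cur qh qt ∧
      N.pot B f (Function.update c A (c A + 1)) (Function.update off A 0) Q cur qh qt <
        N.pot B f c off Q cur qh qt := by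
  obtain ⟨hc, hA, hAk, hp, hp', hs⟩ := hv
  constructor
  · refine { h with
      c_le := ?_
      c_nonneg := ?_
      off_nonneg := ?_
      off_lt := ?_
      swept := ?_
      pending := ?_ }
    · intro A' h1 h2
      by_cases e : A' = A
      · subst e; simpa using hf
      · simpa [e] using h.c_le A' h1 h2
    · intro A' h1 h2
      have := h.c_nonneg A' h1 h2
      by_cases e : A' = A
      · subst e; simp; omega
      · simpa [e] using this
    · intro A' h1 h2
      by_cases e : A' = A
      · subst e; simp
      · simpa [e] using h.off_nonneg A' h1 h2
    · intro A' h1 h2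
      by_cases e : A' = A
      · subst e; simpa using hN.st_lt A' h1 h2
      · simpa [e] using h.off_lt A' h1 h2
    · intro A' p h1 h2 h3
      by_cases e : A' = A
      · subst e; simp; omega
      · simpa [e] using h.swept A' p h1 h2 h3
    · intro A' h1 h2
      by_cases e : A' = A
      · subst e; exact Or.inr ⟨cur - 1, hp, hp', Or.inl ⟨by omega, rfl⟩⟩
      · simpa [e] using h.pending A' h1 h2
  · have := sum_arc_update (N := N) (B := B) (c := c) (off := off) (x := c A + 1) (y := 0) hA hAk
    unfold pot
    rw [this]
    have := h.off_lt A hA hAk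
    nlinarith

/-- A completed sweep shows that all heads exceed the level, and by integrality they allow `c A +
1`. The end `qt` of the queue serves as clock, since every further raise appends one entry. -/
theorem Iter.raise_witnessed (h : N.Iter B f c off a Q cur qh qt) (hv : N.Violated f c off cur A)
    (hN : N.Valid) (hlt : ¬ N.st A + off A + 1 < N.st (A + 1)) (hf : f (N.tl A) < c A + 1) :
    ∃ rank, N.Witnessed (Function.update f (N.tl A) (c A + 1)) (Function.update a (N.tl A) A)
      rank (qt + 1) := by
  obtain ⟨hc, hA, hAk, hp, hp', hs⟩ := hv
  obtain ⟨rank, hr⟩ := h.witnessed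
  refine ⟨_, hr.raise hN hA hAk hf ?_ (h.qh_nonneg.trans h.qh_le)⟩
  intro p h1 h2
  by_cases e' : p = N.st A + off A
  · subst e'; omega
  · have := h.swept A p hA hAk h1 (by omega)
    omega

theorem Iter.raise (h : N.Iter B f c off a Q cur qh qt) (hv : N.Violated f c off cur A)
    (hN : N.Valid) (hlt : ¬ N.st A + off A + 1 < N.st (A + 1)) (hf : f (N.tl A) < c A + 1)
    (hB : ¬ B < c A + 1) :
    N.Iter B (Function.update f (N.tl A) (c A + 1)) (Function.update c A (c A + 1))
        (Function.update off A 0) (Function.update a (N.tl A) A) (Function.update Q qt (N.tl A))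
        cur qh (qt + 1) ∧
      N.pot B (Function.update f (N.tl A) (c A + 1)) (Function.update c A (c A + 1))
        (Function.update off A 0) (Function.update Q qt (N.tl A)) cur qh (qt + 1) <
        N.pot B f c off Q cur qh qt := by
  have hw := h.raise_witnessed hv hN hlt hf
  obtain ⟨hc, hA, hAk, hp, hp', hs⟩ := hv
  have hfc := h.c_le A hA hAk
  have t0 := hN.tl_nonneg A hA hAk
  have t1 := hN.tl_lt A hA hAk
  have q0 := h.qh_le
  have hmono : ∀ v, f v ≤ Function.update f (N.tl A) (c A + 1) v := by
    intro v
    by_cases e : v = N.tl A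
    · subst e; simp; omega
    · simp [e]
  constructor
  · constructor
    · intro v h1 h2
      by_cases e : v = N.tl A
      · subst e; simpa using hB
      · simpa [e] using h.f_le v h1 h2
    · intro A' h1 h2
      by_cases e : A' = A
      · subst e; simp
      · simpa [e] using (h.c_le A' h1 h2).trans (hmono _)
    · intro A' h1 h2
      have := h.c_nonneg A' h1 h2
      by_cases e : A' = A
      · subst e; simp; omega
      · simpa [e] using this
    · intro A' h1 h2
      by_cases e : A' = A
      · subst e; simp
      · simpa [e] using h.off_nonneg A' h1 h2
    · intro A' h1 h2
      by_cases e : A' = A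
      · subst e; simpa using hN.st_lt A' h1 h2
      · simpa [e] using h.off_lt A' h1 h2
    · intro A' p h1 h2 h3
      by_cases e : A' = A
      · subst e; simp; omega
      · simp only [Function.update_of_ne e]
        intro h4
        have := h.swept A' p h1 h2 h3 h4
        have := hmono (N.hd p)
        omega
    · exact h.qh_nonneg
    · omega
    · intro i h1 h2
      by_cases e : i = qt
      · subst e; simpa using t0
      · simpa [e] using h.Q_nonneg i h1 (by omega)
    · intro i h1 h2
      by_cases e : i = qt
      · subst e; simpa using t1
      · simpa [e] using h.Q_lt i h1 (by omega)
    · exact h.cur_nonneg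
    · exact h.cur_le
    · intro A' h1 h2
      by_cases e : A' = A
      · subst e; exact Or.inr ⟨cur - 1, hp, hp', Or.inl ⟨by omega, rfl⟩⟩
      · simp only [Function.update_of_ne e]
        have o1 := h.off_lt A' h1 h2
        have o0 := h.off_nonneg A' h1 h2
        -- If the pointer of another hyperarc stands at the raised node, the new queue entry makes
        -- that hyperarc pending; otherwise its pointer test is unaffected.
        by_cases et : N.hd (N.st A' + off A') = N.tl A
        · exact Or.inr ⟨_, by omega, o1, Or.inr ⟨qt, q0, by omega, by simp [et]⟩⟩
        · rw [Function.update_of_ne et]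
          rcases h.pending A' h1 h2 with h3 | ⟨p, h3, h4, h5 | ⟨i, h5, h6, h7⟩⟩
          · exact Or.inl h3
          · exact Or.inr ⟨p, h3, h4, Or.inl h5⟩
          · exact Or.inr ⟨p, h3, h4, Or.inr ⟨i, h5, by omega, by
              rw [Function.update_of_ne (by omega), h7]⟩⟩
    · exact hw
  · have h1 := sum_arc_update (N := N) (B := B) (c := c) (off := off) (x := c A + 1) (y := 0) hA hAk
    have h2 := sum_Ico_congr_except (n := N.n)
      (F := fun v => (B + 1 - Function.update f (N.tl A) (c A + 1) v) * N.cnt v N.M)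
      (G := fun v => (B + 1 - f v) * N.cnt v N.M) t0 t1 (by intro v hv; simp [hv])
    have h3 : ∑ i ∈ Finset.Ico qh (qt + 1), (N.cnt (Function.update Q qt (N.tl A) i) N.M + 1) =
        N.cnt (N.tl A) N.M + 1 + ∑ i ∈ Finset.Ico qh qt, (N.cnt (Q i) N.M + 1) := by
      rw [← Finset.insert_Ico_right_eq_Ico_add_one q0, Finset.sum_insert (by simp)]
      simp only [Function.update_self]
      congr 1
      refine Finset.sum_congr rfl fun i hi => ?_
      simp only [Finset.mem_Ico] at hi
      rw [Function.update_of_ne (by omega)]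
    unfold pot
    rw [h1, h2, h3]
    simp only [Function.update_self]
    have h4 := N.cnt_nonneg (N.tl A) N.M
    have h5 := h.off_lt A hA hAk
    -- The value rises by at least one, which pays the in-degree of the new queue entry. The
    -- remaining `1` of that entry is covered by the drop of the hyperarc sum, which is one and
    -- counts twice: this is the reason for the factor `2` in `pot`.
    have h6 : f (N.tl A) * N.cnt (N.tl A) N.M ≤ c A * N.cnt (N.tl A) N.M :=
      mul_le_mul_of_nonneg_right (by omega) h4
    nlinarith

/-! ### Extraction of a negative cycle -/

/-- The marked nodes form the node set of a negative cycle with hyperarcs `a v`. -/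
structure IsNegative (N : ArrayNet) (a mark : ℤ → ℤ) : Prop where
  mark_eq : ∀ v, mark v = 0 ∨ mark v = 1
  exists_mark : ∃ v, 0 ≤ v ∧ v < N.n ∧ mark v = 1
  a_nonneg : ∀ v, 0 ≤ v → v < N.n → mark v = 1 → 0 ≤ a v
  a_lt : ∀ v, 0 ≤ v → v < N.n → mark v = 1 → a v < N.k
  tl_a : ∀ v, 0 ≤ v → v < N.n → mark v = 1 → N.tl (a v) = v
  closed : ∀ v p, 0 ≤ v → v < N.n → mark v = 1 → N.st (a v) ≤ p → p < N.st (a v + 1) →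
    mark (N.hd p) = 1
  exists_potential : ∃ (R : ℤ) (φ : ℤ → ℤ), 0 < R ∧
    ∀ v p, 0 ≤ v → v < N.n → mark v = 1 → N.st (a v) ≤ p → p < N.st (a v + 1) →
      R * N.w p < φ (N.hd p) - φ v

/-- Invariant of the search for the nodes that are reachable from a root through the
hyperarcs `a v`; all positions below `x` have been examined since the last change. -/
structure Search (N : ArrayNet) (W : ℤ) (f a g mark : ℤ → ℤ) (x : ℤ) : Prop where
  mark_eq : ∀ v, mark v = 0 ∨ mark v = 1
  exists_mark : ∃ v, 0 ≤ v ∧ v < N.n ∧ mark v = 1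
  x_nonneg : 0 ≤ x
  x_le : x ≤ N.M
  f_lt : ∀ v, 0 ≤ v → v < N.n → mark v = 1 →
    W * (N.n - ∑ u ∈ Finset.Ico 0 N.n, mark u) < f v
  closed : ∀ p, 0 ≤ p → p < x → mark (N.tl (g p)) = 1 → a (N.tl (g p)) = g p → mark (N.hd p) = 1

variable {W : ℤ} {mark : ℤ → ℤ} {x r : ℤ}

theorem Search.sum_le (h : N.Search W f a g mark x) (hN : N.Valid) :
    ∑ u ∈ Finset.Ico 0 N.n, mark u ≤ N.n := by
  calc _ ≤ ∑ u ∈ Finset.Ico 0 N.n, (1 : ℤ) :=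
        Finset.sum_le_sum fun u _ => by rcases h.mark_eq u with e | e <;> omega
    _ = N.n := by simp [hN.n_nonneg]

theorem sum_mark_update {v : ℤ} (h0 : 0 ≤ v) (h1 : v < N.n) (h : mark v = 0) :
    ∑ u ∈ Finset.Ico 0 N.n, Function.update mark v 1 u = ∑ u ∈ Finset.Ico 0 N.n, mark u + 1 := by
  rw [sum_Ico_congr_except h0 h1 (G := mark) (by intro u hu; simp [hu])]
  simp [h]

theorem Search.init (hN : N.Valid) (hW : 0 ≤ W) (hr : 0 ≤ r) (hrn : r < N.n)
    (hf : N.n * W < f r) : N.Search W f a g (Function.update (fun _ => 0) r 1) 0 where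
  mark_eq := by intro v; by_cases e : v = r <;> simp [e]
  exists_mark := ⟨r, hr, hrn, by simp⟩
  x_nonneg := le_rfl
  x_le := hN.M_nonneg
  f_lt := by
    intro v _ _
    by_cases e : v = r
    · subst e
      rw [sum_mark_update hr hrn rfl]
      simp
      nlinarith
    · simp [e]
  closed := by intros; omega

theorem Search.pass (h : N.Search W f a g mark x) (hx : x < N.M)
    (hc : mark (N.tl (g x)) = 1 → a (N.tl (g x)) = g x → mark (N.hd x) = 1) :
    N.Search W f a g mark (x + 1) :=
  { h with
    x_nonneg := by have := h.x_nonneg; omega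
    x_le := by omega
    closed := by
      intro p h1 h2
      by_cases e : p = x
      · subst e; exact hc
      · exact h.closed p h1 (by omega) }

/-- Passing to a head of a chosen hyperarc costs at most `W` in value, and the new mark lowers the
bound in `f_lt` by exactly `W`. Positivity of the value at the old node is what makes its witness
available. -/
theorem Search.visit (h : N.Search W f a g mark x) (hN : N.Valid) (ht : N.Tables g fst nxt N.M)
    {rank : ℤ → ℤ} {T : ℤ} (hw : N.Witnessed f a rank T) (hW : ∀ p, 0 ≤ p → p < N.M → |N.w p| ≤ W)
    (hx : x < N.M) (h1 : mark (N.tl (g x)) = 1) (h2 : a (N.tl (g x)) = g x)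
    (h3 : mark (N.hd x) = 0) : N.Search W f a g (Function.update mark (N.hd x) 1) 0 := by
  have hx0 := h.x_nonneg
  have g0 := ht.g_nonneg x hx0 hx
  have g1 := ht.g_lt x hx0 hx
  have t0 := hN.tl_nonneg _ g0 g1
  have t1 := hN.tl_lt _ g0 g1
  have W0 := hW x hx0 hx
  have W1 := abs_le.1 W0
  have hsum := sum_mark_update (hN.hd_nonneg x hx0 hx) (hN.hd_lt x hx0 hx) h3
  have hle := h.sum_le hN
  refine ⟨?_, ?_, le_rfl, hN.M_nonneg, ?_, by intros; omega⟩
  · intro v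
    by_cases e : v = N.hd x
    · simp [e]
    · simpa [e] using h.mark_eq v
  · obtain ⟨v, e0, e1, e2⟩ := h.exists_mark
    refine ⟨v, e0, e1, ?_⟩
    by_cases e : v = N.hd x
    · simp [e]
    · simpa [e] using e2
  · intro v v0 v1
    rw [hsum]
    by_cases e : v = N.hd x
    · subst e
      intro _
      have h4 := h.f_lt _ t0 t1 h1
      have h5 : 0 < f (N.tl (g x)) := by nlinarith
      have h6 := hw.le _ x t0 t1 h5 (by rw [h2]; exact ht.st_le x hx0 hx)
        (by rw [h2]; exact ht.lt_st x hx0 hx)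
      nlinarith
    · simp only [Function.update_of_ne e]
      intro hm
      have := h.f_lt v v0 v1 hm
      nlinarith

theorem Search.isNegative (h : N.Search W f a g mark N.M) (hN : N.Valid)
    (ht : N.Tables g fst nxt N.M) {rank : ℤ → ℤ} {T : ℤ} (hw : N.Witnessed f a rank T)
    (hW0 : 0 ≤ W) : N.IsNegative a mark := by
  have hle := h.sum_le hN
  have hf : ∀ v, 0 ≤ v → v < N.n → mark v = 1 → 0 < f v := by
    intro v v0 v1 hm
    have := h.f_lt v v0 v1 hm
    nlinarith
  obtain ⟨r, r0, r1, hr⟩ := h.exists_mark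
  have hT : 0 < T := (hw.rank_nonneg r r0 r1).trans_lt (hw.rank_lt r r0 r1)
  refine ⟨h.mark_eq, ⟨r, r0, r1, hr⟩, fun v v0 v1 hm => hw.a_nonneg v v0 v1 (hf v v0 v1 hm),
    fun v v0 v1 hm => hw.a_lt v v0 v1 (hf v v0 v1 hm),
    fun v v0 v1 hm => hw.tl_a v v0 v1 (hf v v0 v1 hm), ?_, T, fun v => T * f v - rank v, hT, ?_⟩
  · intro v p v0 v1 hm p0 p1
    have h0 := hf v v0 v1 hm
    have a0 := hw.a_nonneg v v0 v1 h0
    have a1 := hw.a_lt v v0 v1 h0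
    have a2 := hw.tl_a v v0 v1 h0
    have hg := ht.g_eq hN a0 a1 p0 p1
    have s0 := hN.st_nonneg a0 a1.le
    have s1 := hN.st_le (A := a v + 1) (by omega) (by omega)
    exact h.closed p (by omega) (by omega) (by rw [hg, a2, hm]) (by rw [hg, a2])
  · intro v p v0 v1 hm p0 p1
    have h0 := hf v v0 v1 hm
    have a0 := hw.a_nonneg v v0 v1 h0
    have a1 := hw.a_lt v v0 v1 h0
    have s0 := hN.st_nonneg a0 a1.le
    have s1 := hN.st_le (A := a v + 1) (by omega) (by omega)
    have d0 := hN.hd_nonneg p (by omega) (by omega)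
    have d1 := hN.hd_lt p (by omega) (by omega)
    have k0 := hw.rank_nonneg v v0 v1
    have k1 := hw.rank_lt _ d0 d1
    have l := hw.le v p v0 v1 h0 p0 p1
    -- In the first case integrality gains `T`, more than any difference of ranks in `[0, T)`; in
    -- the second the fall of the rank gives strictness.
    rcases hw.lt v p v0 v1 h0 p0 p1 with l' | l'
    · nlinarith
    · nlinarith

end ArrayNet

/-! ### The program and its phases -/

namespace HyTNProg

open RAM Prog

/-- The number of positions and the constant `1`. -/
def prologue : Prog := const 4 1 ;; load 2 1 1

/-- Process one position: enter its hyperarc and link it into the list of its head. -/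
def tableBody : Prog :=
  add 9 7 4 ;; load 10 1 9 ;; cond 8 10 skip (add 7 7 4) ;; store 4 8 7 ;;
  load 11 2 8 ;; load 12 5 11 ;; store 6 8 12 ;;
  load 13 3 8 ;; cond 5 13 (add 5 13 3) skip ;; sub 13 3 13 ;; cond 5 13 (add 5 13 3) skip ;;
  add 8 8 4 ;; store 5 11 8

/-- Put one node into the queue. -/
def queueBody : Prog := store 7 14 14 ;; add 6 6 5 ;; add 14 14 4

/-- Raise the value of the tail `X_12` to `X_10` on behalf of the hyperarc `X_7`. -/
def raise : Prog :=
  store 8 12 10 ;; store 11 12 7 ;; store 7 14 12 ;; add 14 14 4 ;;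
  add 21 12 3 ;; cond 6 10 (const 20 2) skip

/-- Advance the sweep pointer of the violated hyperarc `X_7`. -/
def advance : Prog :=
  add 18 18 4 ;; add 19 19 4 ;; add 11 7 4 ;; load 11 1 11 ;;
  cond 19 11 (store 10 7 18)
    (store 10 7 3 ;; add 10 10 4 ;; store 9 7 10 ;; load 12 0 7 ;; load 13 8 12 ;;
      cond 13 10 raise skip)

/-- One step of the value iteration. -/
def iterBody : Prog :=
  cond 3 16
    (sub 17 16 4 ;; load 7 4 17 ;; load 18 10 7 ;; load 19 1 7 ;; add 19 19 18 ;;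
      load 9 2 19 ;; load 9 8 9 ;; load 10 3 19 ;; sub 9 9 10 ;; load 10 9 7 ;;
      cond 10 9 advance (load 16 6 17))
    (cond 15 14 (load 9 7 15 ;; load 16 5 9 ;; add 15 15 4) (const 20 1))

/-- Mark the head of the position `X_8` if it is the head of a chosen hyperarc of a marked node,
and start anew; otherwise go to the next position. -/
def searchBody : Prog :=
  load 7 4 8 ;; load 9 0 7 ;; load 10 12 9 ;; load 11 11 9 ;; load 13 2 8 ;; load 17 12 13 ;;
  add 8 8 4 ;;
  cond 3 10 (cond 17 4 (cond 7 11 skip (cond 11 7 skip (store 12 13 4 ;; const 8 0))) skip) skip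

/-- Decide whether the hyperarc `X_8` belongs to the cycle. -/
def arcsBody : Prog :=
  load 9 0 8 ;; load 10 12 9 ;; load 11 11 9 ;; const 13 0 ;;
  cond 3 10 (cond 8 11 skip (cond 11 8 skip (const 13 1))) skip ;; store 1 8 13 ;; add 8 8 4

/-- Copy one cell of the array `m` to the array `0`. -/
def copyBody (m : ℕ) : Prog := load 9 m 8 ;; store 0 8 9 ;; add 8 8 4

/-- Output the negative cycle. -/
def cycleOutput : Prog :=
  (store 12 21 4 ;; const 8 0) ;; loop 8 2 searchBody ;; const 8 0 ;; loop 8 1 arcsBody ;;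
  const 8 0 ;; loop 8 0 (copyBody 12) ;; const 0 0

/-- Output the schedule. -/
def scheduleOutput : Prog := const 8 0 ;; loop 8 0 (copyBody 8) ;; const 0 1

/-- The whole algorithm. -/
def main : Prog :=
  prologue ;; loop 8 2 tableBody ;; loop 14 0 queueBody ;; loop 20 4 iterBody ;;
  cond 4 20 cycleOutput scheduleOutput

variable {N : ArrayNet}

def Holds (N : ArrayNet) (σ : State) : Prop :=
  σ.reg 0 = N.n ∧ σ.reg 1 = N.k ∧ σ.reg 2 = N.M ∧ σ.reg 3 = 0 ∧ σ.reg 4 = 1 ∧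
  σ.arr 0 = N.tl ∧ σ.arr 1 = N.st ∧ σ.arr 2 = N.hd ∧ σ.arr 3 = N.w

/-- The state is an input state for `N`. -/
structure Start (N : ArrayNet) (σ : State) : Prop where
  n : σ.reg 0 = N.n
  k : σ.reg 1 = N.k
  reg : ∀ x, 2 ≤ x → σ.reg x = 0
  tl : σ.arr 0 = N.tl
  st : σ.arr 1 = N.st
  hd : σ.arr 2 = N.hd
  w : σ.arr 3 = N.w
  arr : ∀ m, 4 ≤ m → σ.arr m = fun _ => 0

/-- `W` is the maximal absolute value of the weights at the positions below `x`. -/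
structure IsMaxWeight (N : ArrayNet) (W x : ℤ) : Prop where
  nonneg : 0 ≤ W
  bound : ∀ p, 0 ≤ p → p < x → -W ≤ N.w p ∧ N.w p ≤ W
  le : ∀ U, 0 ≤ U → (∀ p, 0 ≤ p → p < N.M → -U ≤ N.w p ∧ N.w p ≤ U) → W ≤ U

/-- Cells not touched by the preparation, so that the iteration starts from zero values without
clearing arrays. -/
def IterFresh (σ : State) : Prop :=
  σ.reg 15 = 0 ∧ σ.reg 16 = 0 ∧ σ.reg 20 = 0 ∧ (σ.arr 8 = fun _ => 0) ∧ (σ.arr 9 = fun _ => 0) ∧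
  (σ.arr 10 = fun _ => 0) ∧ (σ.arr 11 = fun _ => 0) ∧ (σ.arr 12 = fun _ => 0)

/-- In `arc` the upper bound is not strict: the hyperarc counter may lag behind by one, and one
increment repairs it because no hyperarc is empty. -/
structure TableInv (N : ArrayNet) (σ : State) : Prop where
  holds : Holds N σ
  tables : N.Tables (σ.arr 4) (σ.arr 5) (σ.arr 6) (σ.reg 8)
  nonneg : 0 ≤ σ.reg 7
  p_nonneg : 0 ≤ σ.reg 8
  p_le : σ.reg 8 ≤ N.M
  arc : σ.reg 8 < N.M →
    σ.reg 7 < N.k ∧ N.st (σ.reg 7) ≤ σ.reg 8 ∧ σ.reg 8 ≤ N.st (σ.reg 7 + 1)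
  weight : IsMaxWeight N (σ.reg 5) (σ.reg 8)
  fresh : σ.reg 6 = 0 ∧ σ.reg 14 = 0 ∧ IterFresh σ

structure TablesReady (N : ArrayNet) (σ : State) : Prop where
  holds : Holds N σ
  tables : N.Tables (σ.arr 4) (σ.arr 5) (σ.arr 6) N.M
  weight : IsMaxWeight N (σ.reg 5) N.M

/-- The machine cannot multiply, so the bound `n * W` is accumulated in register `6`, one summand
per queued node. -/
structure QueueInv (N : ArrayNet) (σ : State) : Prop where
  ready : TablesReady N σ
  nonneg : 0 ≤ σ.reg 14
  le : σ.reg 14 ≤ N.n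
  queue : ∀ i, 0 ≤ i → i < σ.reg 14 → σ.arr 7 i = i
  bound : σ.reg 6 = σ.reg 14 * σ.reg 5
  fresh : IterFresh σ

/-- Register `20` is the status: `0` while running, `1` for a feasible schedule, `2` once the value
of the node in register `21` exceeds the bound. -/
structure IterInv (N : ArrayNet) (σ : State) : Prop where
  ready : TablesReady N σ
  bound : σ.reg 6 = N.n * σ.reg 5
  fresh : σ.arr 12 = fun _ => 0
  cases : (σ.reg 20 = 0 ∧ N.Iter (σ.reg 6) (σ.arr 8) (σ.arr 9) (σ.arr 10) (σ.arr 11) (σ.arr 7)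
      (σ.reg 16) (σ.reg 15) (σ.reg 14)) ∨
    (σ.reg 20 = 1 ∧ N.Satisfied (σ.arr 8)) ∨
    (σ.reg 20 = 2 ∧ (∃ rank T, N.Witnessed (σ.arr 8) (σ.arr 11) rank T) ∧ 0 ≤ σ.reg 21 ∧
      σ.reg 21 < N.n ∧ σ.reg 6 < σ.arr 8 (σ.reg 21))

noncomputable def iterPot (N : ArrayNet) (σ : State) : ℤ :=
  N.pot (σ.reg 6) (σ.arr 8) (σ.arr 9) (σ.arr 10) (σ.arr 7) (σ.reg 16) (σ.reg 15) (σ.reg 14)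

theorem prologue_spec (hN : N.Valid) {σ : State} (h : Start N σ) :
    Reaches prologue σ (cost prologue) (TableInv N) := by
  refine Reaches.of_wp ?_
  have hr := h.reg
  have ha := h.arr
  simp only [prologue, wp]
  refine ⟨?_, ?_, ?_, ?_, ?_, ?_, ⟨?_, ?_, ?_⟩, ?_⟩
  · simp [Holds, h.n, h.k, h.tl, h.st, h.hd, h.w, hr, hN.st_k]
  · simpa [hr, ha] using ArrayNet.Tables.zero
  · simp [hr]
  · simp [hr]
  · simpa [hr] using hN.M_nonneg
  · simp only [State.setReg_reg, h.k]
    simp only [Nat.reduceEqDiff, if_false, hr 8, hr 7, hN.st_zero, zero_add, le_refl, Nat.reduceLeDiff]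
    intro hM
    have hk := hN.k_nonneg
    have h0 : N.k ≠ 0 := by
      intro h0
      have h1 := hN.st_k
      rw [h0, hN.st_zero] at h1
      omega
    have h1 := hN.st_lt 0 le_rfl (by omega)
    rw [hN.st_zero] at h1
    simp only [zero_add] at h1
    exact ⟨by omega, trivial, h1.le⟩
  · simp [hr]
  · intro p hp; simp [hr]; omega
  · intro U hU; simp [hr, hU]
  · simp [IterFresh, hr, ha]

theorem IsMaxWeight.step {W W' p : ℤ} (h : IsMaxWeight N W p) (hp : 0 ≤ p) (hpM : p < N.M)
    (h1 : W ≤ W') (h2 : -W' ≤ N.w p) (h3 : N.w p ≤ W')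
    (h4 : W' = W ∨ W' = N.w p ∨ W' = - N.w p) : IsMaxWeight N W' (p + 1) := by
  refine ⟨h.nonneg.trans h1, fun q hq hq' => ?_, fun U hU hb => ?_⟩
  · by_cases c : q = p
    · subst c; exact ⟨h2, h3⟩
    · have := h.bound q hq (by omega)
      omega
  · have := h.le U hU hb
    have := hb p hp hpM
    omega

theorem TableInv.step {σ τ : State} (h : TableInv N σ) {A : ℤ} (hlt : σ.reg 8 < N.M)
    (hA : 0 ≤ A) (hk : A < N.k) (hs : N.st A ≤ σ.reg 8)
    (hs' : σ.reg 8 < N.st (A + 1)) (hτ : Holds N τ) (h4 : τ.arr 4 = Function.update (σ.arr 4) (σ.reg 8) A)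
    (h5 : τ.arr 5 = Function.update (σ.arr 5) (N.hd (σ.reg 8)) (σ.reg 8 + 1))
    (h6 : τ.arr 6 = Function.update (σ.arr 6) (σ.reg 8) (σ.arr 5 (N.hd (σ.reg 8))))
    (h7 : τ.reg 7 = A) (h8 : τ.reg 8 = σ.reg 8 + 1) (hW : IsMaxWeight N (τ.reg 5) (σ.reg 8 + 1))
    (hf : τ.reg 6 = 0 ∧ τ.reg 14 = 0 ∧ IterFresh τ) : TableInv N τ := by
  refine ⟨hτ, ?_, by omega, ?_, by omega, ?_, by rwa [h8], hf⟩
  · rw [h4, h5, h6, h8]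
    exact h.tables.step h.p_nonneg hA hk hs hs'
  · have := h.p_nonneg; omega
  · intro _; rw [h7, h8]; omega

theorem tableBody_spec (hN : N.Valid) (σ : State) (h : TableInv N σ) (hlt : σ.reg 8 < σ.reg 2) :
    Reaches tableBody σ (cost tableBody) fun τ =>
      TableInv N τ ∧ (τ.reg 8 < τ.reg 2 → N.M - τ.reg 8 < N.M - σ.reg 8) := by
  refine Reaches.of_wp ?_
  obtain ⟨⟨e0, e1, e2, e3, e4, a0, a1, a2, a3⟩, ht, h0, hp0, hp, harc, hw, hf⟩ := id h
  rw [e2] at hlt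
  obtain ⟨hk, hs, hs'⟩ := harc hlt
  simp only [tableBody, wp, State.setReg_reg, State.setReg_arr, State.setArr_reg,
    State.setArr_arr, Nat.reduceEqDiff, if_true, if_false, e3, e4, a1, a2, a3, add_zero, zero_sub]
  have hw0 := hw.nonneg
  simp only [IterFresh] at hf
  constructor
  · intro c
    -- The cases are the two comparisons that replace the running maximum by the weight or by its
    -- negative.
    refine ⟨fun c1 => ⟨fun c2 => ?_, fun c2 => ?_⟩, fun c1 => ⟨fun c2 => ?_, fun c2 => ?_⟩⟩ <;>
    · refine ⟨h.step hlt h0 hk hs c ?_ ?_ ?_ ?_ ?_ ?_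
        (hw.step hp0 hlt ?_ ?_ ?_ ?_) ?_, fun _ => by omega⟩ <;>
      first
      | simp [Holds, IterFresh, *]; done
      | simp; omega
  · intro c
    have hA : σ.reg 7 + 1 < N.k := by
      by_contra hA
      have := hN.st_k
      rw [show N.k = σ.reg 7 + 1 by omega] at this
      omega
    have hs1 := hN.st_lt (σ.reg 7 + 1) (by omega) hA
    refine ⟨fun c1 => ⟨fun c2 => ?_, fun c2 => ?_⟩, fun c1 => ⟨fun c2 => ?_, fun c2 => ?_⟩⟩ <;>
    · refine ⟨h.step (A := σ.reg 7 + 1) hlt (by omega) hA (by omega) (by omega) ?_ ?_ ?_ ?_ ?_ ?_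
        (hw.step hp0 hlt ?_ ?_ ?_ ?_) ?_, fun _ => by omega⟩ <;>
      first
      | simp [Holds, IterFresh, *]; done
      | simp; omega

theorem TableInv.queueInv (hN : N.Valid) {σ : State} (h : TableInv N σ)
    (hlt : ¬ σ.reg 8 < σ.reg 2) : QueueInv N σ := by
  obtain ⟨hh, ht, h0, hp0, hp, harc, hw, h6, h14, hf⟩ := h
  rw [hh.2.2.1] at hlt
  have e : σ.reg 8 = N.M := by omega
  rw [e] at ht hw
  refine ⟨⟨hh, ht, hw⟩, by omega, ?_, ?_, ?_, hf⟩
  · rw [h14]; exact hN.n_nonneg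
  · intro i; omega
  · rw [h6, h14, zero_mul]

theorem queueBody_spec (σ : State) (h : QueueInv N σ) (hlt : σ.reg 14 < σ.reg 0) :
    Reaches queueBody σ (cost queueBody) fun τ =>
      QueueInv N τ ∧ (τ.reg 14 < τ.reg 0 → N.n - τ.reg 14 < N.n - σ.reg 14) := by
  refine Reaches.of_wp ?_
  obtain ⟨⟨hh, ht, hw⟩, h0, hn, hq, hb, hf⟩ := h
  have e4 : σ.reg 4 = 1 := hh.2.2.2.2.1
  rw [hh.1] at hlt
  simp only [queueBody, wp, State.setReg_reg, State.setArr_reg, Nat.reduceEqDiff, if_true, if_false, e4]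
  refine ⟨⟨⟨by simpa [Holds] using hh, by simpa using ht, by simpa using hw⟩, ?_, ?_, ?_, ?_, ?_⟩,
    fun _ => by omega⟩
  · simp; omega
  · simp; omega
  · intro i hi
    by_cases c : i = σ.reg 14
    · simp [c]
    · simp only [State.setReg_reg, State.setReg_arr, State.setArr_arr, Nat.reduceEqDiff, if_true,
        if_false, Function.update_of_ne c]
      intro hi'
      exact hq i hi (by omega)
  · simp [hb]; ring
  · simpa [IterFresh] using hf

theorem IterInv.init (hN : N.Valid) {σ : State} (h : QueueInv N σ) (hlt : ¬ σ.reg 14 < σ.reg 0) :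
    IterInv N σ := by
  obtain ⟨hr, h0, hn, hq, hb, hf⟩ := h
  rw [hr.holds.1] at hlt
  have e : σ.reg 14 = N.n := by omega
  rw [e] at hb hq
  obtain ⟨f15, f16, f20, f8, f9, f10, f11, f12⟩ := hf
  refine ⟨hr, hb, f12, Or.inl ⟨f20, ?_⟩⟩
  rw [f15, f16, f8, f9, f10, f11, e]
  exact ArrayNet.Iter.init hN (by rw [hb]; exact mul_nonneg hN.n_nonneg hr.weight.nonneg) hq

theorem iterPot_init (hN : N.Valid) {σ : State} (h : QueueInv N σ)
    (hlt : ¬ σ.reg 14 < σ.reg 0) :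
    iterPot N σ = 3 * (N.n * σ.reg 5 + 1) * N.M + N.M + N.n := by
  obtain ⟨hr, h0, hn, hq, hb, hf⟩ := h
  rw [hr.holds.1] at hlt
  have e : σ.reg 14 = N.n := by omega
  rw [e] at hb hq
  obtain ⟨f15, f16, f20, f8, f9, f10, f11, f12⟩ := hf
  rw [iterPot, f15, f16, f8, f9, f10, e, ArrayNet.pot_init hN hq, hb]

theorem IterInv.iter {σ : State} (h : IterInv N σ) (hlt : σ.reg 20 < σ.reg 4) :
    σ.reg 20 = 0 ∧ N.Iter (σ.reg 6) (σ.arr 8) (σ.arr 9) (σ.arr 10) (σ.arr 11)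
      (σ.arr 7) (σ.reg 16) (σ.reg 15) (σ.reg 14) := by
  have e4 : σ.reg 4 = 1 := h.ready.holds.2.2.2.2.1
  rw [e4] at hlt
  rcases h.cases with hc | hc | hc
  · exact hc
  · omega
  · omega

theorem IterInv.pot_nonneg (hN : N.Valid) {σ : State} (h : IterInv N σ)
    (hlt : σ.reg 20 < σ.reg 4) : 0 ≤ iterPot N σ :=
  (h.iter hlt).2.pot_nonneg hN

theorem iterBody_spec (hN : N.Valid) (σ : State) (h : IterInv N σ) (hlt : σ.reg 20 < σ.reg 4) :
    Reaches iterBody σ (cost iterBody) fun τ =>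
      IterInv N τ ∧ (τ.reg 20 < τ.reg 4 → iterPot N τ < iterPot N σ) := by
  refine Reaches.of_wp ?_
  obtain ⟨r20, hI⟩ := h.iter hlt
  obtain ⟨⟨hh, ht, hw⟩, hb, hf, hc⟩ := h
  obtain ⟨e0, e1, e2, e3, e4, a0, a1, a2, a3⟩ := id hh
  simp only [iterBody, advance, raise, wp, State.setReg_reg, State.setReg_arr, State.setArr_reg,
    State.setArr_arr, Nat.reduceEqDiff, if_true, if_false, e3, e4, a0, a1, a2, a3, add_zero]
  -- The branches are, in order: sweep, raise beyond the bound, raise, lift, next position, pop, and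
  -- stop with everything satisfied.
  refine ⟨fun hcur => ⟨fun hv => ⟨fun hs => ?_, fun hs => ⟨fun hr => ⟨fun hB => ?_, fun hB => ?_⟩,
    fun hr => ?_⟩⟩, fun hv => ?_⟩, fun hcur => ⟨fun hq => ?_, fun hq => ?_⟩⟩
  · have key := hI.sweep (hI.violated ht hcur hv) hs
    refine ⟨⟨⟨by simpa [Holds] using hh, by simpa using ht, by simpa using hw⟩, by simpa using hb,
      by simpa using hf, Or.inl ?_⟩, fun _ => ?_⟩
    · simpa [r20] using key.1
    · simpa [iterPot] using key.2
  · have key := hI.raise_witnessed (hI.violated ht hcur hv) hN hs hr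
    have v0 := (hI.violated ht hcur hv).nonneg
    have v1 := (hI.violated ht hcur hv).lt
    refine ⟨⟨⟨by simpa [Holds] using hh, by simpa using ht, by simpa using hw⟩, by simpa using hb,
      by simpa using hf, Or.inr (Or.inr ?_)⟩, by norm_num⟩
    obtain ⟨rank, hk⟩ := key
    refine ⟨by simp, ⟨rank, _, by simpa using hk⟩, ?_, ?_, ?_⟩
    · simpa using hN.tl_nonneg _ v0 v1
    · simpa using hN.tl_lt _ v0 v1
    · simpa using hB
  · have key := hI.raise (hI.violated ht hcur hv) hN hs hr hB
    refine ⟨⟨⟨by simpa [Holds] using hh, by simpa using ht, by simpa using hw⟩, by simpa using hb,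
      by simpa using hf, Or.inl ?_⟩, fun _ => ?_⟩
    · simpa [r20] using key.1
    · simpa [iterPot] using key.2
  · have key := hI.lift (hI.violated ht hcur hv) hN hs hr
    refine ⟨⟨⟨by simpa [Holds] using hh, by simpa using ht, by simpa using hw⟩, by simpa using hb,
      by simpa using hf, Or.inl ?_⟩, fun _ => ?_⟩
    · simpa [r20] using key.1
    · simpa [iterPot] using key.2
  · have key := hI.next hN ht hcur hv
    refine ⟨⟨⟨by simpa [Holds] using hh, by simpa using ht, by simpa using hw⟩, by simpa using hb,
      by simpa using hf, Or.inl ?_⟩, fun _ => ?_⟩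
    · simpa [r20] using key.1
    · simpa [iterPot] using key.2
  · have key := hI.pop hN ht hcur hq
    refine ⟨⟨⟨by simpa [Holds] using hh, by simpa using ht, by simpa using hw⟩, by simpa using hb,
      by simpa using hf, Or.inl ?_⟩, fun _ => ?_⟩
    · simpa [r20] using key.1
    · simpa [iterPot] using key.2
  · have key := hI.satisfied hN hcur hq
    exact ⟨⟨⟨by simpa [Holds] using hh, by simpa using ht, by simpa using hw⟩, by simpa using hb,
      by simpa using hf, Or.inr (Or.inl ⟨by simp, by simpa using key⟩)⟩, by norm_num⟩

/-! ### Search and output phases -/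

structure SearchInv (N : ArrayNet) (f a : ℤ → ℤ) (σ : State) : Prop where
  ready : TablesReady N σ
  a_eq : σ.arr 11 = a
  search : N.Search (σ.reg 5) f a (σ.arr 4) (σ.arr 12) (σ.reg 8)

/-- A lexicographic measure: a new mark restarts the scan, which costs at most `M`, and therefore
weighs `M + 1`. -/
noncomputable def searchPot (N : ArrayNet) (σ : State) : ℤ :=
  (N.n - ∑ v ∈ Finset.Ico 0 N.n, σ.arr 12 v) * (N.M + 1) + (N.M - σ.reg 8)

theorem SearchInv.pot_nonneg (hN : N.Valid) {f a : ℤ → ℤ} {σ : State} (h : SearchInv N f a σ) :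
    0 ≤ searchPot N σ := by
  have h1 := h.search.sum_le hN
  have h2 := hN.M_nonneg
  have h3 := h.search.x_le
  unfold searchPot
  nlinarith

theorem searchBody_spec (hN : N.Valid) {f a rank : ℤ → ℤ} {T : ℤ}
    (hwit : N.Witnessed f a rank T) (σ : State) (h : SearchInv N f a σ)
    (hlt : σ.reg 8 < σ.reg 2) :
    Reaches searchBody σ (cost searchBody) fun τ =>
      SearchInv N f a τ ∧ (τ.reg 8 < τ.reg 2 → searchPot N τ < searchPot N σ) := by
  refine Reaches.of_wp ?_
  obtain ⟨⟨hh, ht, hw⟩, rfl, hs⟩ := h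
  obtain ⟨e0, e1, e2, e3, e4, a0, a1, a2, a3⟩ := id hh
  rw [e2] at hlt
  have hx := hs.x_nonneg
  simp only [searchBody, wp, State.setReg_reg, State.setReg_arr, State.setArr_reg,
    Nat.reduceEqDiff, if_true, if_false, e3, e4, a0, a2]
  have pass : ∀ τ : State, Holds N τ → τ.arr 4 = σ.arr 4 → τ.arr 5 = σ.arr 5 → τ.arr 6 = σ.arr 6 →
      τ.reg 5 = σ.reg 5 → τ.arr 11 = σ.arr 11 → τ.arr 12 = σ.arr 12 → τ.reg 8 = σ.reg 8 + 1 →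
      (σ.arr 12 (N.tl (σ.arr 4 (σ.reg 8))) = 1 → σ.arr 11 (N.tl (σ.arr 4 (σ.reg 8))) =
        σ.arr 4 (σ.reg 8) → σ.arr 12 (N.hd (σ.reg 8)) = 1) →
      SearchInv N f (σ.arr 11) τ ∧ (σ.reg 8 + 1 < τ.reg 2 → searchPot N τ < searchPot N σ) := by
    intro τ t1 t2 t3 t4 t5 t6 t7 t8 hc
    refine ⟨⟨⟨t1, by rwa [t2, t3, t4], by rwa [t5]⟩, t6, ?_⟩, fun _ => ?_⟩
    · rw [t5, t2, t7, t8]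
      exact hs.pass hlt hc
    · unfold searchPot
      rw [t7, t8]
      omega
  have hm := hs.mark_eq
  refine ⟨fun h1 => ⟨fun h2 => ⟨fun h3 => ?_, fun h3 => ⟨fun h4 => ?_, fun h4 => ?_⟩⟩,
    fun h2 => ?_⟩, fun h1 => ?_⟩
  · exact pass _ (by simpa [Holds] using hh) (by simp) (by simp) (by simp) (by simp) (by simp)
      (by simp) (by simp) (by intros; omega)
  · exact pass _ (by simpa [Holds] using hh) (by simp) (by simp) (by simp) (by simp) (by simp)
      (by simp) (by simp) (by intros; omega)
  · have h5 : σ.arr 12 (N.tl (σ.arr 4 (σ.reg 8))) = 1 := by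
      rcases hm (N.tl (σ.arr 4 (σ.reg 8))) with e | e <;> omega
    have h6 : σ.arr 12 (N.hd (σ.reg 8)) = 0 := by
      rcases hm (N.hd (σ.reg 8)) with e | e <;> omega
    refine ⟨⟨⟨by simpa [Holds] using hh, by simpa using ht, by simpa using hw⟩, by simp, ?_⟩,
      fun _ => ?_⟩
    · simpa using hs.visit hN ht hwit (fun p p0 p1 => abs_le.2 (hw.bound p p0 p1)) hlt h5
        (by omega) h6
    · have := ArrayNet.sum_mark_update (hN.hd_nonneg _ hx hlt) (hN.hd_lt _ hx hlt) h6
      simp only [searchPot, State.setReg_reg, State.setReg_arr, State.setArr_arr,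
        if_true]
      rw [this]
      nlinarith
  · exact pass _ (by simpa [Holds] using hh) (by simp) (by simp) (by simp) (by simp) (by simp)
      (by simp) (by simp) (by intros; rcases hm (N.hd (σ.reg 8)) with e | e <;> omega)
  · exact pass _ (by simpa [Holds] using hh) (by simp) (by simp) (by simp) (by simp) (by simp)
      (by simp) (by simp) (by intros; omega)

/-- The first `x` hyperarcs have been examined for membership in the cycle. -/
structure ArcsInv (N : ArrayNet) (a mark : ℤ → ℤ) (σ : State) : Prop where
  n : σ.reg 0 = N.n
  k : σ.reg 1 = N.k
  zero : σ.reg 3 = 0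
  one : σ.reg 4 = 1
  tl : σ.arr 0 = N.tl
  a_eq : σ.arr 11 = a
  mark_eq : σ.arr 12 = mark
  nonneg : 0 ≤ σ.reg 8
  le : σ.reg 8 ≤ N.k
  mem : ∀ A, 0 ≤ A → A < σ.reg 8 → (σ.arr 1 A = 1 ↔ mark (N.tl A) = 1 ∧ a (N.tl A) = A)

theorem arcsBody_spec {a mark : ℤ → ℤ} (hm : ∀ v, mark v = 0 ∨ mark v = 1) (σ : State)
    (h : ArcsInv N a mark σ) (hlt : σ.reg 8 < σ.reg 1) :
    Reaches arcsBody σ (cost arcsBody) fun τ =>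
      ArcsInv N a mark τ ∧ (τ.reg 8 < τ.reg 1 → N.k - τ.reg 8 < N.k - σ.reg 8) := by
  refine Reaches.of_wp ?_
  obtain ⟨e0, e1, e3, e4, a0, a11, a12, h0, hk, hA⟩ := h
  rw [e1] at hlt
  simp only [arcsBody, wp, State.setReg_reg, State.setReg_arr, State.setArr_reg,
    Nat.reduceEqDiff, if_true, if_false, e3, e4, a0, a11, a12]
  have step : ∀ (τ : State) (b : ℤ), τ.reg 0 = N.n → τ.reg 1 = N.k → τ.reg 3 = 0 → τ.reg 4 = 1 →
      τ.arr 0 = N.tl → τ.arr 11 = a → τ.arr 12 = mark → τ.reg 8 = σ.reg 8 + 1 →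
      τ.arr 1 = Function.update (σ.arr 1) (σ.reg 8) b →
      (b = 1 ↔ mark (N.tl (σ.reg 8)) = 1 ∧ a (N.tl (σ.reg 8)) = σ.reg 8) →
      ArcsInv N a mark τ ∧ (σ.reg 8 + 1 < τ.reg 1 → N.k - (σ.reg 8 + 1) < N.k - σ.reg 8) := by
    intro τ b t0 t1 t3 t4 s0 s11 s12 t8 s1 hb
    refine ⟨⟨t0, t1, t3, t4, s0, s11, s12, by omega, by omega, ?_⟩, fun _ => by omega⟩
    intro A hA0 hA1
    rw [s1]
    by_cases c : A = σ.reg 8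
    · subst c; simpa using hb
    · rw [Function.update_of_ne c]; exact hA A hA0 (by omega)
  have hm' := hm (N.tl (σ.reg 8))
  refine ⟨fun h1 => ⟨fun h2 => ?_, fun h2 => ⟨fun h3 => ?_, fun h3 => ?_⟩⟩, fun h1 => ?_⟩
  · exact step _ 0 (by simpa using e0) (by simpa using e1) (by simpa using e3) (by simpa using e4)
      (by simpa using a0) (by simpa using a11) (by simpa using a12) (by simp) (by simp) (by omega)
  · exact step _ 0 (by simpa using e0) (by simpa using e1) (by simpa using e3) (by simpa using e4)
      (by simpa using a0) (by simpa using a11) (by simpa using a12) (by simp) (by simp) (by omega)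
  · exact step _ 1 (by simpa using e0) (by simpa using e1) (by simpa using e3) (by simpa using e4)
      (by simpa using a0) (by simpa using a11) (by simpa using a12) (by simp) (by simp) (by omega)
  · exact step _ 0 (by simpa using e0) (by simpa using e1) (by simpa using e3) (by simpa using e4)
      (by simpa using a0) (by simpa using a11) (by simpa using a12) (by simp) (by simp) (by omega)

/-- The first cells of `F` have been copied to the array `0`; the array `1` is `G`. -/
structure CopyInv (n : ℤ) (m : ℕ) (F G : ℤ → ℤ) (σ : State) : Prop where
  reg_n : σ.reg 0 = n
  one : σ.reg 4 = 1
  src : σ.arr m = F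
  other : σ.arr 1 = G
  nonneg : 0 ≤ σ.reg 8
  le : σ.reg 8 ≤ n
  copied : ∀ v, 0 ≤ v → v < σ.reg 8 → σ.arr 0 v = F v

theorem copyBody_spec {n : ℤ} {m : ℕ} {F G : ℤ → ℤ} (hm : m ≠ 0) (σ : State)
    (h : CopyInv n m F G σ) (hlt : σ.reg 8 < σ.reg 0) :
    Reaches (copyBody m) σ (cost (copyBody m)) fun τ =>
      CopyInv n m F G τ ∧ (τ.reg 8 < τ.reg 0 → n - τ.reg 8 < n - σ.reg 8) := by
  refine Reaches.of_wp ?_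
  obtain ⟨e0, e4, h1, h2, h3, h4, h5⟩ := h
  rw [e0] at hlt
  simp only [copyBody, wp, State.setReg_reg, State.setArr_reg,
    Nat.reduceEqDiff, if_true, if_false, e4, h1]
  refine ⟨⟨by simpa using e0, by simpa using e4, by simpa [hm] using h1, by simpa using h2,
    by simp; omega, by simp; omega, ?_⟩, fun _ => by omega⟩
  intro v v0
  by_cases c : v = σ.reg 8
  · simp [c]
  · simp only [State.setReg_reg, State.setReg_arr, State.setArr_arr, if_true,
      Function.update_of_ne c]
    intro v1
    exact h5 v v0 (by omega)

/-- The two possible results: a feasible schedule or a negative cycle. -/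
def Result (N : ArrayNet) (τ : State) : Prop :=
  (τ.reg 0 = 1 ∧ ∃ f, N.Satisfied f ∧ ∀ v, 0 ≤ v → v < N.n → τ.arr 0 v = f v) ∨
  (τ.reg 0 = 0 ∧ ∃ a mark, N.IsNegative a mark ∧ (∀ v, 0 ≤ v → v < N.n → τ.arr 0 v = mark v) ∧
    ∀ A, 0 ≤ A → A < N.k → (τ.arr 1 A = 1 ↔ mark (N.tl A) = 1 ∧ a (N.tl A) = A))

theorem copy_spec {n : ℤ} {m : ℕ} {F G : ℤ → ℤ} (hm : m ≠ 0) (hn : 0 ≤ n) (b : ℤ) {σ : State}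
    (e0 : σ.reg 0 = n) (e4 : σ.reg 4 = 1) (h : σ.arr m = F) (hG : σ.arr 1 = G) :
    Reaches (const 8 0 ;; loop 8 0 (copyBody m) ;; const 0 b) σ
      (1 + ((cost (copyBody m) + 1) * (n + 1).toNat + 1 + 1)) fun τ =>
      τ.reg 0 = b ∧ τ.arr 1 = G ∧ ∀ v, 0 ≤ v → v < n → τ.arr 0 v = F v := by
  refine (Reaches.of_wp (P := const 8 0) (Q := fun τ => CopyInv n m F G τ ∧ τ.reg 8 = 0) ?_).seq
    fun τ hτ => ?_
  · refine ⟨⟨by simpa using e0, by simpa using e4, by simpa using h, by simpa using hG,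
      by simp, by simpa using hn, ?_⟩, by simp⟩
    intro v; simp; omega
  · have := Reaches.loop (Φ := fun τ => n - τ.reg 8)
      (fun σ h _ => sub_nonneg.2 h.le) (copyBody_spec hm) τ hτ.1
    rw [hτ.2, sub_zero] at this
    refine this.seq fun ρ hρ => Reaches.of_wp (P := const 0 b) ?_
    obtain ⟨⟨h1, h2, h3, h4, h5, h6, h7⟩, h8⟩ := hρ
    refine ⟨by simp, by simpa using h4, ?_⟩
    intro v v0 v1
    simpa using h7 v v0 (by omega)

theorem scheduleOutput_spec (hN : N.Valid) {σ : State} (h : IterInv N σ) (h20 : σ.reg 20 = 1) :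
    Reaches scheduleOutput σ (1 + (4 * (N.n + 1).toNat + 1 + 1)) (Result N) := by
  obtain ⟨⟨hh, ht, hw⟩, hb, hf, hc⟩ := h
  have hs : N.Satisfied (σ.arr 8) := by
    rcases hc with hc | hc | hc
    · omega
    · exact hc.2
    · omega
  -- The factor `4` of the claimed time is `cost (copyBody 8) + 1` evaluated.
  refine (copy_spec (by norm_num) hN.n_nonneg 1 hh.1 hh.2.2.2.2.1 rfl rfl).mono le_rfl ?_
  intro τ hτ
  exact Or.inl ⟨hτ.1, _, hs, hτ.2.2⟩

theorem cycleOutput_spec (hN : N.Valid) {σ : State} (h : IterInv N σ) (h20 : σ.reg 20 = 2) :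
    Reaches cycleOutput σ (2 + ((cost searchBody + 1) * ((N.n + 1) * (N.M + 1)).toNat + 1 +
      (1 + ((cost arcsBody + 1) * (N.k + 1).toNat + 1 + (1 + (4 * (N.n + 1).toNat + 1 + 1))))))
      (Result N) := by
  obtain ⟨⟨hh, ht, hw⟩, hb, hf, hc⟩ := h
  obtain ⟨⟨rank, T, hwit⟩, r0, r1, hr⟩ : (∃ rank T, N.Witnessed (σ.arr 8) (σ.arr 11) rank T) ∧
      0 ≤ σ.reg 21 ∧ σ.reg 21 < N.n ∧ σ.reg 6 < σ.arr 8 (σ.reg 21) := by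
    rcases hc with hc | hc | hc
    · omega
    · omega
    · exact hc.2
  rw [hb] at hr
  refine (Reaches.of_wp (P := store 12 21 4 ;; const 8 0) (Q := fun τ =>
    SearchInv N (σ.arr 8) (σ.arr 11) τ ∧ searchPot N τ + 1 ≤ (N.n + 1) * (N.M + 1)) ?_).seq
    fun τ hτ => ?_
  · have key := ArrayNet.Search.init (a := σ.arr 11) (g := σ.arr 4) hN hw.nonneg r0 r1 hr
    have e4 := hh.2.2.2.2.1
    have M0 := hN.M_nonneg
    simp only [wp]
    refine ⟨⟨⟨by simpa [Holds] using hh, by simpa using ht, by simpa using hw⟩, by simp, ?_⟩, ?_⟩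
    · simpa [hf, e4] using key
    · simp only [searchPot, State.setReg_reg, State.setReg_arr, State.setArr_arr,
        if_true, hf, e4]
      rw [ArrayNet.sum_mark_update r0 r1 rfl]
      simp
      nlinarith
  have key := Reaches.loop (Φ := searchPot N) (fun σ h _ => h.pot_nonneg hN)
    (searchBody_spec hN hwit) τ hτ.1
  refine (key.mono (Nat.add_le_add_right (Nat.mul_le_mul_left _ (Int.toNat_le_toNat hτ.2)) 1)
    fun _ h => h).seq fun τ hτ => ?_
  obtain ⟨⟨⟨hh, ht, hw⟩, ha, hs⟩, hlt⟩ := hτ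
  rw [hh.2.2.1] at hlt
  have hx : τ.reg 8 = N.M := le_antisymm hs.x_le (not_lt.1 hlt)
  rw [hx] at hs
  have hneg := hs.isNegative hN ht hwit hw.nonneg
  -- The hyperarcs are tested before the marks are copied, as copying destroys the tails in array
  -- `0`. The test overwrites array `1`, whose starting positions are no longer needed.
  refine (Reaches.of_wp (P := const 8 0) (Q := fun ρ =>
    ArcsInv N (σ.arr 11) (τ.arr 12) ρ ∧ ρ.reg 8 = 0) ?_).seq fun ρ hρ => ?_
  · obtain ⟨e0, e1, e2, e3, e4, a0, a1, a2, a3⟩ := hh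
    refine ⟨⟨by simpa using e0, by simpa using e1, by simpa using e3, by simpa using e4,
      by simpa using a0, by simpa using ha, by simp, by simp, by simpa using hN.k_nonneg, ?_⟩,
      by simp⟩
    intro A; simp; omega
  have key := Reaches.loop (Φ := fun σ => N.k - σ.reg 8) (fun σ h _ => sub_nonneg.2 h.le)
    (arcsBody_spec (N := N) (a := σ.arr 11) hs.mark_eq) ρ hρ.1
  rw [hρ.2, sub_zero] at key
  refine key.seq fun ρ hρ => ?_
  obtain ⟨hρ, hlt⟩ := hρ
  rw [hρ.k] at hlt
  have hx : ρ.reg 8 = N.k := le_antisymm hρ.le (not_lt.1 hlt)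
  refine (copy_spec (by norm_num) hN.n_nonneg 0 hρ.n hρ.one hρ.mark_eq rfl).mono le_rfl ?_
  intro π hπ
  refine Or.inr ⟨hπ.1, _, _, hneg, hπ.2.2, ?_⟩
  rw [hπ.2.1, ← hx]
  exact hρ.mem

theorem output_spec (hN : N.Valid) {σ : State} (h : IterInv N σ) (h20 : ¬ σ.reg 20 < σ.reg 4) :
    Reaches (cond 4 20 cycleOutput scheduleOutput) σ
      (2 + ((cost searchBody + 1) * ((N.n + 1) * (N.M + 1)).toNat + 1 +
        (1 + ((cost arcsBody + 1) * (N.k + 1).toNat + 1 + (1 + (4 * (N.n + 1).toNat + 1 + 1))))) + 1)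
      (Result N) := by
  have e4 : σ.reg 4 = 1 := h.ready.holds.2.2.2.2.1
  rw [e4] at h20
  refine Reaches.cond (fun c => cycleOutput_spec hN h ?_)
    fun c => (scheduleOutput_spec hN h ?_).mono (by omega) fun _ h => h
  · rw [e4] at c
    rcases h.cases with hc | hc | hc <;> omega
  · rw [e4] at c
    rcases h.cases with hc | hc | hc <;> omega

/-! ### Total running time -/

theorem linear_bound {c x d Y : ℕ} (h : x ≤ d * Y) (hY : 1 ≤ Y) : c * x + 1 ≤ (c * d + 1) * Y := by
  nlinarith [Nat.mul_le_mul_left c h]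

/-- The constant of the time bound. -/
def timeConst : ℕ :=
  cost prologue + ((cost tableBody + 1) * 2 + 1 + ((cost queueBody + 1) * 2 + 1 +
    ((cost iterBody + 1) * 9 + 1 + (((cost searchBody + 1) * 4 + 1) + ((cost arcsBody + 1) * 2 + 1) +
      (4 * 2 + 1) + 6))))

/-- The algorithm returns a feasible schedule or a negative cycle within the time bound. -/
theorem main_spec (hN : N.Valid) {a m W : ℕ} (ha : 1 ≤ a) (hm : 1 ≤ m) (hW : 1 ≤ W)
    (hn : N.n ≤ a) (hk : N.k ≤ a) (hM : N.M ≤ m)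
    (hw : ∀ p, 0 ≤ p → p < N.M → -(W : ℤ) ≤ N.w p ∧ N.w p ≤ W) {σ : State} (h : Start N σ) :
    Reaches main σ (timeConst * (a * m * W)) (Result N) := by
  have n0 := hN.n_nonneg
  have M0 := hN.M_nonneg
  have ham : 1 ≤ a * m := Nat.mul_pos ha hm
  obtain ⟨Y, hY⟩ : ∃ Y, Y = a * m * W := ⟨_, rfl⟩
  have hY1 : 1 ≤ Y := by rw [hY]; exact Nat.mul_pos ham hW
  have hYam : a * m ≤ Y := by rw [hY]; exact Nat.le_mul_of_pos_right _ hW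
  have hYa : a ≤ Y := (Nat.le_mul_of_pos_right _ hm).trans hYam
  have hYm : m ≤ Y := (Nat.le_mul_of_pos_left _ ha).trans hYam
  have hnM : N.n * N.M ≤ Y :=
    (mul_le_mul hn hM M0 (by omega)).trans (by exact_mod_cast hYam)
  rw [← hY]
  have hT : timeConst * Y = cost prologue * Y + (((cost tableBody + 1) * 2 + 1) * Y +
      (((cost queueBody + 1) * 2 + 1) * Y + (((cost iterBody + 1) * 9 + 1) * Y +
      (((cost searchBody + 1) * 4 + 1) * Y + ((cost arcsBody + 1) * 2 + 1) * Y +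
        (4 * 2 + 1) * Y + 6 * Y)))) := by
    unfold timeConst; ring
  rw [hT]
  refine ((prologue_spec hN h).mono (Nat.le_mul_of_pos_right _ hY1) fun _ h => h).seq
    fun τ hτ => ?_
  refine ((Reaches.loop (Φ := fun σ => N.M - σ.reg 8) (fun σ h _ => sub_nonneg.2 h.p_le)
    (tableBody_spec hN) τ hτ).mono (linear_bound (d := 2) (Y := Y) ?_ hY1)
    fun _ h => TableInv.queueInv hN h.1 h.2).seq fun τ hτ => ?_
  · have := hτ.p_nonneg
    omega
  refine ((Reaches.loop (Φ := fun σ => N.n - σ.reg 14) (fun σ h _ => sub_nonneg.2 h.le)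
    queueBody_spec τ hτ).mono (Q' := fun τ => IterInv N τ ∧
      iterPot N τ = 3 * (N.n * τ.reg 5 + 1) * N.M + N.M + N.n) (linear_bound (d := 2) (Y := Y) ?_ hY1)
    fun _ h => ⟨IterInv.init hN h.1 h.2, iterPot_init hN h.1 h.2⟩).seq fun τ hτ => ?_
  · have := hτ.nonneg
    omega
  obtain ⟨hτ, hpot⟩ := hτ
  -- The constant `9` is `3 + 4 + 1 + 1`, from the initial potential `3 * n * W * M + 4 * M + n` and
  -- the extra `1` of the loop rule, each monomial being at most `Y`.
  refine ((Reaches.loop (Φ := iterPot N) (fun σ h c => h.pot_nonneg hN c)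
    (iterBody_spec hN) τ hτ).mono (linear_bound (d := 9) (Y := Y) ?_ hY1)
    fun _ h => h).seq fun τ hτ => ?_
  · have h1 : τ.reg 5 ≤ W := hτ.ready.weight.le W (by omega) hw
    have h2 : N.n * τ.reg 5 * N.M ≤ Y := by
      calc N.n * τ.reg 5 * N.M = N.n * N.M * τ.reg 5 := by ring
        _ ≤ (a * m : ℤ) * W := mul_le_mul (mul_le_mul hn hM M0 (by omega)) h1
            hτ.ready.weight.nonneg (by positivity)
        _ = Y := by rw [hY]; push_cast; ring
    have h3 : iterPot N τ = 3 * (N.n * τ.reg 5 * N.M) + 4 * N.M + N.n := by rw [hpot]; ring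
    omega
  · refine (output_spec hN hτ.1 hτ.2).mono ?_ fun _ h => h
    have h1 := linear_bound (c := cost searchBody + 1) (x := ((N.n + 1) * (N.M + 1)).toNat) (d := 4)
      (Y := Y) (by
        have : (N.n + 1) * (N.M + 1) = N.n * N.M + N.n + N.M + 1 := by ring
        omega) hY1
    have h2 := linear_bound (c := cost arcsBody + 1) (x := (N.k + 1).toNat) (d := 2) (Y := Y)
      (by omega) hY1
    have h3 := linear_bound (c := 4) (x := (N.n + 1).toNat) (d := 2) (Y := Y) (by omega) hY1
    omega

end HyTNProg

/-! ### From the input state to the array form and back -/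

open RAM

theorem RAM.arrayOfList_natCast (l : List ℤ) (i : ℕ) : arrayOfList l i = l.getD i 0 := by
  simp [arrayOfList]

theorem List.getD_flatMap {α : Type*} (F : α → List ℤ) (l : List α) (i j : ℕ) (hi : i < l.length)
    (hj : j < (F l[i]).length) :
    (l.flatMap F).getD (((l.take i).map fun a => (F a).length).sum + j) 0 = (F l[i]).getD j 0 := by
  induction l generalizing i with
  | nil => simp at hi
  | cons b l ih =>
    cases i with
    | zero =>
      simp only [List.getElem_cons_zero] at hj
      simp [List.getElem?_append_left hj]
    | succ i =>
      simp only [List.length_cons, Nat.add_lt_add_iff_right] at hi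
      simp only [List.getElem_cons_succ] at hj
      have := ih i hi hj
      simp only [List.flatMap_cons, List.take_succ_cons, List.map_cons, List.sum_cons, add_assoc,
        List.getElem_cons_succ]
      rw [List.getD_append_right _ _ _ _ (Nat.le_add_right _ _), Nat.add_sub_cancel_left, this]

namespace HyTN

variable {n k : ℕ} (H : HyTN (Fin n) (Fin k)) (L : H.Listing)

/-- The position where the heads of the hyperarc `j` start. -/
def startPos (j : ℕ) : ℕ := (((List.finRange k).take j).map fun A => (L.list A).length).sum

/-- The network in array form that is given by the input state. -/
def arrayNet : ArrayNet where
  n := n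
  k := k
  M := startPos H L k
  tl := (H.input L).arr 0
  st := (H.input L).arr 1
  hd := (H.input L).arr 2
  w := (H.input L).arr 3

theorem start : HyTNProg.Start (H.arrayNet L) (H.input L) where
  n := rfl
  k := rfl
  reg := by
    intro x hx
    match x, hx with
    | x + 2, _ => rfl
  tl := rfl
  st := rfl
  hd := rfl
  w := rfl
  arr := by
    intro x hx
    match x, hx with
    | x + 4, _ => rfl

theorem startPos_succ (A : Fin k) :
    startPos H L (A + 1) = startPos H L A + (L.list A).length := by
  unfold startPos
  rw [List.take_add_one, List.map_append, List.sum_append]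
  simp

theorem arrayNet_tl (A : Fin k) : (H.arrayNet L).tl ((A : ℕ) : ℤ) = ((H.arc A).tail : ℕ) := by
  simp [arrayNet, input, arrayOfList_natCast]

theorem arrayNet_st {j : ℕ} (hj : j ≤ k) : (H.arrayNet L).st (j : ℤ) = startPos H L j := by
  simp [arrayNet, input, arrayOfList_natCast, startPos, Nat.lt_succ_of_le hj]

/-- Unfolding the input leaves the cast of the heads in monadic form; this is the shape to which
`List.getD_flatMap` applies. -/
theorem input_arr_two : (H.input L).arr 2 =
    arrayOfList ((List.finRange k).flatMap fun A => (L.list A).map fun v : Fin n => ((v : ℕ) : ℤ)) := by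
  simp only [input, List.bind_eq_flatMap, List.pure_def, ← List.map_eq_flatMap, List.map_map]
  rfl

theorem arrayNet_hd (A : Fin k) {j : ℕ} (hj : j < (L.list A).length) :
    (H.arrayNet L).hd ((startPos H L A + j : ℕ) : ℤ) = (((L.list A)[j] : Fin n) : ℕ) := by
  have := List.getD_flatMap (fun A => (L.list A).map fun v : Fin n => ((v : ℕ) : ℤ))
    (List.finRange k) A j (by simp) (by simpa using hj)
  simp only [List.length_map] at this
  simp only [arrayNet, input_arr_two, arrayOfList_natCast, startPos]
  rw [this]
  simp [hj]

theorem arrayNet_w (A : Fin k) {j : ℕ} (hj : j < (L.list A).length) :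
    (H.arrayNet L).w ((startPos H L A + j : ℕ) : ℤ) = (H.arc A).weight (L.list A)[j] := by
  have := List.getD_flatMap (fun A => (L.list A).map fun v => (H.arc A).weight v)
    (List.finRange k) A j (by simp) (by simpa using hj)
  simp only [List.length_map] at this
  simp only [arrayNet, input, arrayOfList_natCast, startPos]
  rw [this]
  simp [hj]

theorem startPos_eq : startPos H L k = ∑ A, (L.list A).length := by
  unfold startPos
  rw [List.take_of_length_le (by simp), ← Fin.sum_univ_def]

/-- Every position belongs to some head of some hyperarc. -/
theorem exists_arc {p : ℕ} (hp : p < startPos H L k) :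
    ∃ (A : Fin k) (j : ℕ), j < (L.list A).length ∧ p = startPos H L A + j := by
  have key : ∀ i ≤ k, p < startPos H L i →
      ∃ (A : Fin k) (j : ℕ), j < (L.list A).length ∧ p = startPos H L A + j := by
    intro i
    induction i with
    | zero => intro _ h; simp [startPos] at h
    | succ i ih =>
      intro hi h
      by_cases c : p < startPos H L i
      · exact ih (by omega) c
      · have := startPos_succ H L ⟨i, hi⟩
        simp only at this
        exact ⟨⟨i, hi⟩, p - startPos H L i, by omega, by simp; omega⟩
  exact key k le_rfl hp

theorem length_list (A : Fin k) : (L.list A).length = (H.arc A).heads.card := by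
  rw [← List.toFinset_card_of_nodup (L.nodup A)]
  congr 1
  ext v
  simp [L.mem_iff]

theorem arrayNet_valid : (H.arrayNet L).Valid where
  n_nonneg := Int.natCast_nonneg _
  k_nonneg := Int.natCast_nonneg _
  st_zero := by simpa [startPos] using arrayNet_st H L (Nat.zero_le k)
  st_k := arrayNet_st H L le_rfl
  st_lt := by
    intro A h0 h1
    lift A to ℕ using h0
    have h1 : A < k := Int.ofNat_lt.1 h1
    have h2 := startPos_succ H L ⟨A, h1⟩
    have h3 := Finset.card_pos.2 (H.arc ⟨A, h1⟩).heads_nonempty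
    rw [← length_list H L] at h3
    have h4 := arrayNet_st H L (j := A + 1) h1
    push_cast at h4
    rw [arrayNet_st H L h1.le, h4]
    simp only at h2
    omega
  tl_nonneg := by
    intro A h0 h1
    lift A to ℕ using h0
    have h1 : A < k := Int.ofNat_lt.1 h1
    rw [arrayNet_tl H L ⟨A, h1⟩]
    exact Int.natCast_nonneg _
  tl_lt := by
    intro A h0 h1
    lift A to ℕ using h0
    have h1 : A < k := Int.ofNat_lt.1 h1
    rw [arrayNet_tl H L ⟨A, h1⟩]
    exact Int.ofNat_lt.2 (H.arc ⟨A, h1⟩).tail.2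
  hd_nonneg := by
    intro p h0 h1
    lift p to ℕ using h0
    obtain ⟨A, j, hj, rfl⟩ := exists_arc H L (p := p) (Int.ofNat_lt.1 h1)
    rw [arrayNet_hd H L A hj]
    exact Int.natCast_nonneg _
  hd_lt := by
    intro p h0 h1
    lift p to ℕ using h0
    obtain ⟨A, j, hj, rfl⟩ := exists_arc H L (p := p) (Int.ofNat_lt.1 h1)
    rw [arrayNet_hd H L A hj]
    exact Int.ofNat_lt.2 ((L.list A)[j]).2
  hd_ne := by
    intro A p h0 h1 h2 h3
    lift A to ℕ using h0
    have h1 : A < k := Int.ofNat_lt.1 h1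
    have h4 := arrayNet_st H L (j := A + 1) h1
    push_cast at h4
    rw [h4, startPos_succ H L ⟨A, h1⟩] at h3
    rw [arrayNet_st H L h1.le] at h2
    obtain ⟨j, rfl⟩ : ∃ j : ℕ, p = ((startPos H L A + j : ℕ) : ℤ) :=
      ⟨(p - startPos H L A).toNat, by push_cast; omega⟩
    have hj : j < (L.list ⟨A, h1⟩).length := by
      simp only at h3
      push_cast at h3
      omega
    rw [arrayNet_hd H L ⟨A, h1⟩ hj, arrayNet_tl H L ⟨A, h1⟩]
    intro he
    have he : (L.list ⟨A, h1⟩)[j] = (H.arc ⟨A, h1⟩).tail := Fin.ext (by exact_mod_cast he)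
    apply (H.arc ⟨A, h1⟩).tail_notMem_heads
    rw [← he, ← L.mem_iff]
    exact List.getElem_mem hj

/-- The positions of a hyperarc correspond to its heads. -/
theorem exists_head (A : Fin k) {p : ℤ} (h0 : (H.arrayNet L).st ((A : ℕ) : ℤ) ≤ p)
    (h1 : p < (H.arrayNet L).st (((A : ℕ) : ℤ) + 1)) : ∃ v ∈ (H.arc A).heads,
      (H.arrayNet L).hd p = ((v : ℕ) : ℤ) ∧ (H.arrayNet L).w p = (H.arc A).weight v := by
  have h4 := arrayNet_st H L (j := A + 1) A.2
  push_cast at h4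
  rw [h4, startPos_succ H L A] at h1
  rw [arrayNet_st H L A.2.le] at h0
  obtain ⟨j, rfl⟩ : ∃ j : ℕ, p = ((startPos H L A + j : ℕ) : ℤ) :=
    ⟨(p - startPos H L A).toNat, by push_cast; omega⟩
  have hj : j < (L.list A).length := by push_cast at h1; omega
  exact ⟨_, (L.mem_iff A _).1 (List.getElem_mem hj), arrayNet_hd H L A hj, arrayNet_w H L A hj⟩

theorem exists_pos (A : Fin k) {v : Fin n} (hv : v ∈ (H.arc A).heads) :
    ∃ p, (H.arrayNet L).st ((A : ℕ) : ℤ) ≤ p ∧ p < (H.arrayNet L).st (((A : ℕ) : ℤ) + 1) ∧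
      (H.arrayNet L).hd p = ((v : ℕ) : ℤ) ∧ (H.arrayNet L).w p = (H.arc A).weight v := by
  have h4 := arrayNet_st H L (j := A + 1) A.2
  push_cast at h4
  rw [h4, startPos_succ H L A, arrayNet_st H L A.2.le]
  obtain ⟨j, hj, rfl⟩ := List.getElem_of_mem ((L.mem_iff A v).2 hv)
  exact ⟨((startPos H L A + j : ℕ) : ℤ), by push_cast; omega, by push_cast; omega,
    arrayNet_hd H L A hj, arrayNet_w H L A hj⟩

theorem arrayNet_w_le (p : ℤ) (h0 : 0 ≤ p) (h1 : p < (H.arrayNet L).M) :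
    -(H.maxWeight : ℤ) ≤ (H.arrayNet L).w p ∧ (H.arrayNet L).w p ≤ H.maxWeight := by
  lift p to ℕ using h0
  obtain ⟨A, j, hj, rfl⟩ := exists_arc H L (p := p) (Int.ofNat_lt.1 h1)
  rw [arrayNet_w H L A hj]
  have h2 : ((H.arc A).weight (L.list A)[j]).natAbs ≤ H.maxWeight :=
    (Finset.le_sup (f := fun h => ((H.arc A).weight h).natAbs)
      ((L.mem_iff A _).1 (List.getElem_mem hj))).trans
    (Finset.le_sup (f := fun A : Fin k =>
      (H.arc A).heads.sup fun h => ((H.arc A).weight h).natAbs) (Finset.mem_univ A))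
  omega

theorem startPos_le_size : startPos H L k ≤ H.size := by
  rw [startPos_eq, size]
  exact Finset.sum_le_sum fun A _ => by rw [length_list]; omega

theorem feasible_of_satisfied {f : ℤ → ℤ} (hf : (H.arrayNet L).Satisfied f) :
    H.Feasible fun v : Fin n => ((f ((v : ℕ) : ℤ) : ℤ) : ℝ) := by
  intro A
  obtain ⟨p, h0, h1, h2⟩ := hf ((A : ℕ) : ℤ) (Int.natCast_nonneg _) (Int.ofNat_lt.2 A.2)
  obtain ⟨v, hv, h3, h4⟩ := exists_head H L A h0 h1
  rw [h3, h4, arrayNet_tl] at h2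
  refine (Finset.inf'_le _ hv).trans ?_
  simp only
  exact_mod_cast h2

/-- A marked node has its chosen hyperarc in the cycle, and membership of a hyperarc forces it to be
the chosen one of its tail, hence uniqueness. Negativity follows by summing the potential inequality
around a cyclic sequence. -/
theorem isNegativeCycle_of_isNegative {a mark F G : ℤ → ℤ} (h : (H.arrayNet L).IsNegative a mark)
    (hF : ∀ v, 0 ≤ v → v < (H.arrayNet L).n → F v = mark v)
    (hG : ∀ A, 0 ≤ A → A < (H.arrayNet L).k →
      (G A = 1 ↔ mark ((H.arrayNet L).tl A) = 1 ∧ a ((H.arrayNet L).tl A) = A)) :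
    H.IsNegativeCycle {v : Fin n | F ((v : ℕ) : ℤ) = 1} {A : Fin k | G ((A : ℕ) : ℤ) = 1} := by
  have hS : ∀ v : Fin n, F ((v : ℕ) : ℤ) = 1 ↔ mark ((v : ℕ) : ℤ) = 1 := fun v => by
    rw [hF _ (Int.natCast_nonneg _) (Int.ofNat_lt.2 v.2)]
  have hC : ∀ A : Fin k, G ((A : ℕ) : ℤ) = 1 ↔
      mark (((H.arc A).tail : ℕ) : ℤ) = 1 ∧ a (((H.arc A).tail : ℕ) : ℤ) = ((A : ℕ) : ℤ) := by
    intro A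
    rw [hG _ (Int.natCast_nonneg _) (Int.ofNat_lt.2 A.2), arrayNet_tl]
  have hclosed : ∀ A : Fin k, G ((A : ℕ) : ℤ) = 1 → ∀ v ∈ (H.arc A).heads,
      F ((v : ℕ) : ℤ) = 1 := by
    intro A hA v hv
    obtain ⟨hm, ha⟩ := (hC A).1 hA
    obtain ⟨p, p0, p1, p2, -⟩ := exists_pos H L A hv
    rw [hS, ← p2]
    exact h.closed _ p (Int.natCast_nonneg _) (Int.ofNat_lt.2 (H.arc A).tail.2) hm
      (by rw [ha]; exact p0) (by rw [ha]; exact p1)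
  have harc : ∀ v : Fin n, F ((v : ℕ) : ℤ) = 1 → ∃ A : Fin k, G ((A : ℕ) : ℤ) = 1 ∧
      (H.arc A).tail = v := by
    intro v hv
    rw [hS] at hv
    have h0 := h.a_nonneg _ (Int.natCast_nonneg _) (Int.ofNat_lt.2 v.2) hv
    have h1 := h.a_lt _ (Int.natCast_nonneg _) (Int.ofNat_lt.2 v.2) hv
    have h2 := h.tl_a _ (Int.natCast_nonneg _) (Int.ofNat_lt.2 v.2) hv
    obtain ⟨A, hA⟩ := Int.eq_ofNat_of_zero_le h0
    rw [hA] at h1 h2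
    have h1 : A < k := Int.ofNat_lt.1 h1
    rw [arrayNet_tl H L ⟨A, h1⟩] at h2
    have ht : (H.arc ⟨A, h1⟩).tail = v := Fin.ext (Int.ofNat_inj.1 h2)
    exact ⟨⟨A, h1⟩, (hC _).2 (by rw [ht]; exact ⟨hv, hA⟩), ht⟩
  refine ⟨⟨?_, ?_, ?_⟩, ?_⟩
  · ext v
    simp only [Set.mem_ofPred_eq, Set.mem_iUnion, Set.mem_union, Finset.mem_coe,
      Set.mem_singleton_iff, exists_prop]
    constructor
    · intro hv
      obtain ⟨A, hA, ht⟩ := harc v hv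
      exact ⟨A, hA, Or.inr ht.symm⟩
    · rintro ⟨A, hA, hv | rfl⟩
      · exact hclosed A hA v hv
      · exact (hS _).2 ((hC A).1 hA).1
  · obtain ⟨v, v0, v1, hv⟩ := h.exists_mark
    lift v to ℕ using v0
    exact ⟨⟨v, Int.ofNat_lt.1 v1⟩, (hS _).2 hv⟩
  · intro v hv
    obtain ⟨A, hA, ht⟩ := harc v hv
    refine ⟨A, ⟨hA, ht⟩, ?_⟩
    rintro A' ⟨hA', ht'⟩
    have e := ((hC A).1 hA).2
    have e' := ((hC A').1 hA').2
    rw [ht] at e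
    rw [ht', e] at e'
    exact Fin.ext (Int.ofNat_inj.1 e'.symm)
  · intro l v b hs
    obtain ⟨R, φ, hR, hφ⟩ := h.exists_potential
    have hlt : ∀ t < l, R * (H.arc (b t)).weight (v (t + 1)) <
        φ ((v (t + 1) : ℕ) : ℤ) - φ ((v t : ℕ) : ℤ) := by
      intro t ht
      obtain ⟨hm, ha⟩ := (hC (b t)).1 (hs.arc_mem t ht)
      obtain ⟨p, p0, p1, p2, p3⟩ := exists_pos H L (b t) (hs.head_mem t ht)
      rw [hs.tail_eq t ht] at hm ha
      have := hφ _ p (Int.natCast_nonneg _) (Int.ofNat_lt.2 (v t).2) hm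
        (by rw [ha]; exact p0) (by rw [ha]; exact p1)
      rwa [p2, p3] at this
    have hsum : R * ∑ t ∈ Finset.range l, (H.arc (b t)).weight (v (t + 1)) < 0 := by
      rw [Finset.mul_sum]
      calc _ < ∑ t ∈ Finset.range l, (φ ((v (t + 1) : ℕ) : ℤ) - φ ((v t : ℕ) : ℤ)) :=
            Finset.sum_lt_sum_of_nonempty (by simpa using hs.pos.ne')
              fun t ht => hlt t (Finset.mem_range.1 ht)
        _ = 0 := by
            rw [Finset.sum_range_sub (fun t => φ ((v t : ℕ) : ℤ)), hs.closed, sub_self]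
    exact (pos_iff_neg_of_mul_neg hsum).1 hR

end HyTN

/-! ### Negative cycles exclude consistency; conclusion -/

namespace HyTN

/-- A network with a negative cycle is not consistent. -/
theorem IsNegativeCycle.not_consistent {V ι : Type*} [Finite V] {H : HyTN V ι} {S : Set V}
    {C : Set ι} (h : H.IsNegativeCycle S C) : ¬ H.Consistent := by
  rintro ⟨s, hs⟩
  obtain ⟨⟨hS, ⟨v₀, hv₀⟩, hu⟩, hneg⟩ := h
  -- At each node of the cycle, choose a head attaining the minimum for the feasible schedule; it
  -- lies in `S` again.
  have hstep : ∀ v : S, ∃ (A : ι) (u : S), A ∈ C ∧ (H.arc A).tail = v ∧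
      (u : V) ∈ (H.arc A).heads ∧ s u - ((H.arc A).weight u : ℝ) ≤ s v := by
    rintro ⟨v, hv⟩
    obtain ⟨A, ⟨hA, ht⟩, -⟩ := hu v hv
    obtain ⟨u, hu, he⟩ := Finset.exists_mem_eq_inf' (H.arc A).heads_nonempty
      (fun v => s v - ((H.arc A).weight v : ℝ))
    have hle := hs A
    rw [he, ht] at hle
    refine ⟨A, ⟨u, ?_⟩, hA, ht, hu, hle⟩
    rw [hS]
    exact Set.mem_biUnion hA (Or.inl hu)
  choose a g ha ht hh hle using hstep
  obtain ⟨i, j, hij, he⟩ := Finite.exists_ne_map_eq_of_infinite fun i => g^[i] ⟨v₀, hv₀⟩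
  wlog hlt : i < j generalizing i j
  · exact this j i hij.symm he.symm (by omega)
  set x := g^[i] ⟨v₀, hv₀⟩ with hx
  have hper : x ∈ Function.periodicPts g := by
    refine Function.mk_mem_periodicPts (n := j - i) (by omega) ?_
    rw [Function.IsPeriodicPt, Function.IsFixedPt, hx, ← Function.iterate_add_apply,
      Nat.sub_add_cancel hlt.le]
    exact he.symm
  -- Finiteness makes the iterates periodic; running through one minimal period ensures that only
  -- the end point is repeated.
  have hcyc : H.IsCyclicSequence C (Function.minimalPeriod g x) (fun t => (g^[t] x : V))
      (fun t => a (g^[t] x)) := by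
    refine ⟨Function.minimalPeriod_pos_of_mem_periodicPts hper, ?_, ?_, fun t _ => ha _,
      fun t _ => ht _, fun t _ => ?_⟩
    · simp [Function.iterate_minimalPeriod]
    · intro t ht u hu he
      exact Function.iterate_injOn_Iio_minimalPeriod ht hu (Subtype.ext he)
    · simp only [Function.iterate_succ_apply']
      exact hh _
  have hlt := hneg _ _ _ hcyc
  have hge : (0 : ℝ) ≤ ∑ t ∈ Finset.range (Function.minimalPeriod g x),
      ((H.arc (a (g^[t] x))).weight (g^[t + 1] x : V) : ℝ) := by
    calc (0 : ℝ) = ∑ t ∈ Finset.range (Function.minimalPeriod g x),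
          (s (g^[t + 1] x) - s (g^[t] x)) := by
          rw [Finset.sum_range_sub (fun t => s (g^[t] x)), Function.iterate_minimalPeriod]
          simp
      _ ≤ _ := by
          refine Finset.sum_le_sum fun t _ => ?_
          have := hle (g^[t] x)
          rw [Function.iterate_succ_apply']
          linarith
  have hge : (0 : ℤ) ≤ ∑ t ∈ Finset.range (Function.minimalPeriod g x),
      (H.arc (a (g^[t] x))).weight (g^[t + 1] x : V) := by exact_mod_cast hge
  exact absurd hlt (not_lt.2 hge)

variable {n k : ℕ} (H : HyTN (Fin n) (Fin k)) (L : H.Listing)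

/-- The two possible outputs of the algorithm, for the network itself. -/
theorem main_result :
    Reaches HyTNProg.main (H.input L)
      (HyTNProg.timeConst * (max (n + k) 1 * max H.size 1 * max H.maxWeight 1)) fun τ =>
      (τ.reg 0 = 1 ∧ H.Feasible fun v : Fin n => ((τ.arr 0 ((v : ℕ) : ℤ) : ℤ) : ℝ)) ∨
      (τ.reg 0 = 0 ∧ H.IsNegativeCycle {v : Fin n | τ.arr 0 ((v : ℕ) : ℤ) = 1}
        {A : Fin k | τ.arr 1 ((A : ℕ) : ℤ) = 1}) := by
  have hsize := startPos_le_size H L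
  refine (HyTNProg.main_spec (arrayNet_valid H L) (le_max_right _ _) (le_max_right _ _)
    (le_max_right _ _) ?_ ?_ ?_ ?_ (H.start L)).mono le_rfl ?_
  · exact Int.ofNat_le.2 (by omega)
  · exact Int.ofNat_le.2 (by omega)
  · exact Int.ofNat_le.2 (by omega)
  · intro p p0 p1
    have := arrayNet_w_le H L p p0 p1
    omega
  · rintro τ (⟨h0, f, hf, hc⟩ | ⟨h0, a, mark, hneg, hF, hG⟩)
    · refine Or.inl ⟨h0, ?_⟩
      have he : (fun v : Fin n => ((τ.arr 0 ((v : ℕ) : ℤ) : ℤ) : ℝ)) =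
          fun v : Fin n => ((f ((v : ℕ) : ℤ) : ℤ) : ℝ) := by
        funext v
        rw [hc _ (Int.natCast_nonneg _) (Int.ofNat_lt.2 v.2)]
      rw [he]
      exact feasible_of_satisfied H L hf
    · exact Or.inr ⟨h0, isNegativeCycle_of_isNegative H L hneg hF hG⟩

end HyTN
theorem mainTheorem2 :
    -- (1) deciding consistency
    (∃ (P : RAM.Prog) (K : ℕ), ∀ (n k : ℕ) (H : HyTN (Fin n) (Fin k)) (L : H.Listing),
      ∃ (τ : RAM.State) (t : ℕ), RAM.Exec P (H.input L) τ t ∧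
        t ≤ K * (max (n + k) 1 * max H.size 1 * max H.maxWeight 1) ∧
        (H.Consistent → τ.reg 0 = 1) ∧ (¬ H.Consistent → τ.reg 0 = 0)) ∧
    -- (2) computing an integral feasible schedule of a consistent network
    (∃ (P : RAM.Prog) (K : ℕ), ∀ (n k : ℕ) (H : HyTN (Fin n) (Fin k)) (L : H.Listing),
      H.Consistent →
      ∃ (τ : RAM.State) (t : ℕ), RAM.Exec P (H.input L) τ t ∧
        t ≤ K * (max (n + k) 1 * max H.size 1 * max H.maxWeight 1) ∧
        H.Feasible (fun v : Fin n => ((τ.arr 0 ((v : ℕ) : ℤ) : ℤ) : ℝ))) ∧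
    -- (3) computing a negative cycle of an inconsistent network
    (∃ (P : RAM.Prog) (K : ℕ), ∀ (n k : ℕ) (H : HyTN (Fin n) (Fin k)) (L : H.Listing),
      ¬ H.Consistent →
      ∃ (τ : RAM.State) (t : ℕ), RAM.Exec P (H.input L) τ t ∧
        t ≤ K * (max (n + k) 1 * max H.size 1 * max H.maxWeight 1) ∧
        H.IsNegativeCycle {v : Fin n | τ.arr 0 ((v : ℕ) : ℤ) = 1}
          {A : Fin k | τ.arr 1 ((A : ℕ) : ℤ) = 1}) := by
  -- One program serves all three parts: a schedule proves consistency and a negative cycle refutes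
  -- it, so the hypothesis selects the outcome.
  refine ⟨⟨HyTNProg.main, HyTNProg.timeConst, fun n k H L => ?_⟩,
    ⟨HyTNProg.main, HyTNProg.timeConst, fun n k H L hc => ?_⟩,
    ⟨HyTNProg.main, HyTNProg.timeConst, fun n k H L hc => ?_⟩⟩
  · obtain ⟨τ, t, he, ht, ⟨h0, hf⟩ | ⟨h0, hn⟩⟩ := H.main_result L
    · exact ⟨τ, t, he, ht, fun _ => h0, fun hc => absurd ⟨_, hf⟩ hc⟩
    · exact ⟨τ, t, he, ht, fun hc => absurd hc hn.not_consistent, fun _ => h0⟩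
  · obtain ⟨τ, t, he, ht, ⟨h0, hf⟩ | ⟨h0, hn⟩⟩ := H.main_result L
    · exact ⟨τ, t, he, ht, hf⟩
    · exact absurd hc hn.not_consistent
  · obtain ⟨τ, t, he, ht, ⟨h0, hf⟩ | ⟨h0, hn⟩⟩ := H.main_result L
    · exact absurd ⟨_, hf⟩ hc
    · exact ⟨τ, t, he, ht, hn⟩
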